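/- **Setting.** Let $d\ge 2$ be a number of objects, $k\ge 1$ a number of criteria, $T\ge 1$, and $q\in[1,\infty]$ (with $1/\infty=0$). Let $\mathbf P\in[0,1]^{d\times d\times k}$ be a preference tensor, i.e. $\mathbf P(i_1,i_2;j)=1-\mathbf P(i_2,i_1;j)$ for all $i_1,i_2,j$, and let $S\subseteq[0,1]^k$ be a nonempty convex target set. For $x,y\in\mathbb R^d$ let $\mathbf P(x,y)\in\mathbb R^k$ be the vector with entries $\sum_{i_1,i_2}x_{i_1}\mathbf P(i_1,i_2;j)\,y_{i_2}$, and write $\mathbf P(x,i)=\mathbf P(x,e_i)$. Let $\rho(z,S)=\inf_{s\in S}\|z-s\|_q$, let $\Delta_d$ be the probability simplex, and for $\pi\in\Delta_d$ let $$v(\pi)=v(\pi;\mathbf P,S,\|\cdot\|_q)=\max_{\pi'\in\Delta_d}\rho(\mathbf P(\pi,\pi'),S).$$ **Algorithm (two-point zeroth-order mirror descent with entropic regularization).** Given a step size $\eta$ and a smoothing radius $\delta>0$, put $\theta_1=0$ and for $t=1,\dots,T$: 1. $\pi_t=\arg\max_{\pi\in\Delta_d}\ \langle\theta_t,\pi\rangle-\sum_i\pi_i\log\pi_i$;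 2. draw $u_t$ uniformly from the Euclidean unit sphere of $\mathbb R^d$, independently of the other draws; 3. $\hat g_t=\frac{d}{2\delta}\bigl(\max_{i}\rho(\mathbf P(\pi_t+\delta u_t,i),S)-\max_{i}\rho(\mathbf P(\pi_t-\delta u_t,i),S)\bigr)u_t$; 4. $\theta_{t+1}=\theta_t-\eta\,\hat g_t$. The output is $\bar\pi_T=\frac1T\sum_{t=1}^T\pi_t$. **Proposition.** For all constants $c_1,c_2>0$ there is a constant $c>0$, depending only on $c_1$ and $c_2$ (and not on $d,k,T,q,\mathbf P,S$), such that in the above setting the algorithm run for $T$ iterations with step size $\eta=\dfrac{c_1}{k^{1/q}\sqrt{dT}}$ and smoothing radius $\delta=\dfrac{c_2\log d}{\sqrt T}$ satisfies $$\mathbb E\bigl[v(\bar\pi_T)\bigr]\ \le\ \min_{\pi\in\Delta_d}v(\pi)\;+\;c\,k^{1/q}\sqrt{\frac{d\log^2 d}{T}},$$ where the minimum is attained, $v(\bar\pi_T)$ is integrable, and the expectation is over $u_1,\dots,u_T$. -/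

import Mathlib

open MeasureTheory ProbabilityTheory
open scoped ENNReal

noncomputable section

namespace BlackwellPref

/-- A tensor `P i₁ i₂ j` of comparison probabilities of `d` objects along `k` criteria. -/
abbrev Tensor (d k : ℕ) : Type := Fin d → Fin d → Fin k → ℝ

/-- The set of preference tensors: entries in `[0, 1]` and `P i₁ i₂ j = 1 - P i₂ i₁ j`. -/
def preferenceTensors (d k : ℕ) : Set (Tensor d k) :=
  {P | (∀ i₁ i₂ j, P i₁ i₂ j ∈ Set.Icc (0 : ℝ) 1) ∧ ∀ i₁ i₂ j, P i₁ i₂ j = 1 - P i₂ i₁ j}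

/-- The score vector `P(x, y)`, with `j`-th entry `xᵀ Pʲ y`; it is bilinear in `x` and `y`, which
need not be probability vectors. -/
def score {d k : ℕ} (P : Tensor d k) (x y : Fin d → ℝ) : Fin k → ℝ :=
  fun j => ∑ i₁, ∑ i₂, x i₁ * P i₁ i₂ j * y i₂

/-- The distance `ρ(z, S) = inf_{s ∈ S} ‖z - s‖_q` in `ℝᵏ`. -/
def lqDist {k : ℕ} (q : ℝ≥0∞) [Fact (1 ≤ q)] (z : Fin k → ℝ) (S : Set (Fin k → ℝ)) : ℝ :=
  Metric.infDist (WithLp.toLp q z) (WithLp.toLp q '' S)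

/-- The objective `v(π; P, S, ‖·‖_q)`: the worst-case distance
`max_{π' ∈ Δ_d} ρ(P(π, π'), S)`. -/
def value {d k : ℕ} (P : Tensor d k) (S : Set (Fin k → ℝ)) (q : ℝ≥0∞) [Fact (1 ≤ q)]
    (x : Fin d → ℝ) : ℝ :=
  ⨆ y : stdSimplex ℝ (Fin d), lqDist q (score P x y) S

/-- The quantity `max_i ρ(P(x, i), S)` over the objects `i` that the algorithm computes from its
queries; the query point `x` is an arbitrary vector, possibly outside the simplex. -/
def queryValue {d k : ℕ} (P : Tensor d k) (S : Set (Fin k → ℝ)) (q : ℝ≥0∞) [Fact (1 ≤ q)]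
    (x : Fin d → ℝ) : ℝ :=
  ⨆ i : Fin d, lqDist q (score P x (Pi.single i 1)) S

/-- The negative entropy `r(x) = ∑ x_i log x_i` (with `0 log 0 = 0`). -/
def negEntropy {d : ℕ} (x : Fin d → ℝ) : ℝ := ∑ i, x i * Real.log (x i)

/-- `x` maximizes `⟨θ, x⟩ - r(x)` over the probability simplex. -/
def IsMirrorStep {d : ℕ} (θ x : Fin d → ℝ) : Prop :=
  x ∈ stdSimplex ℝ (Fin d) ∧
    IsMaxOn (fun y : Fin d → ℝ => ∑ i, θ i * y i - negEntropy y) (stdSimplex ℝ (Fin d)) x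

/-- `argmax_{x ∈ Δ_d} ⟨θ, x⟩ - r(x)`. -/
def mirrorStep {d : ℕ} (θ : Fin d → ℝ) : Fin d → ℝ :=
  Classical.epsilon (IsMirrorStep θ)

theorem isMirrorStep_mirrorStep {d : ℕ} (hd : 0 < d) (θ : Fin d → ℝ) :
    IsMirrorStep θ (mirrorStep θ) := by
  have : Nonempty (Fin d) := ⟨⟨0, hd⟩⟩
  have hne : (stdSimplex ℝ (Fin d)).Nonempty := ⟨_, single_mem_stdSimplex ℝ ⟨0, hd⟩⟩
  have hc : Continuous (fun y : Fin d → ℝ => ∑ i, θ i * y i - negEntropy y) := by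
    unfold negEntropy
    refine Continuous.sub (by fun_prop) (continuous_finsetSum _ fun i _ => ?_)
    exact Real.continuous_mul_log.comp (continuous_apply i)
  obtain ⟨x, hx, hmax⟩ := (isCompact_stdSimplex ℝ (Fin d)).exists_isMaxOn hne hc.continuousOn
  exact Classical.epsilon_spec (p := IsMirrorStep θ) ⟨x, hx, hmax⟩

/-- The two-point estimate
`ĝ = d / (2δ) * (max_i ρ(P(x + δu, i), S) - max_i ρ(P(x - δu, i), S)) u`. -/
def gradEst {d k : ℕ} (P : Tensor d k) (S : Set (Fin k → ℝ)) (q : ℝ≥0∞) [Fact (1 ≤ q)] (δ : ℝ)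
    (x u : Fin d → ℝ) : Fin d → ℝ :=
  ((d : ℝ) / (2 * δ) * (queryValue P S q (x + δ • u) - queryValue P S q (x - δ • u))) • u

/-- The dual iterate before round `t` (rounds are numbered from `0`), for the sampled directions
`u 0, u 1, …`. -/
def dualIterate {d k : ℕ} (P : Tensor d k) (S : Set (Fin k → ℝ)) (q : ℝ≥0∞) [Fact (1 ≤ q)]
    (η δ : ℝ) (u : ℕ → EuclideanSpace ℝ (Fin d)) : ℕ → Fin d → ℝ
  | 0 => 0
  | t + 1 => dualIterate P S q η δ u t -
      η • gradEst P S q δ (mirrorStep (dualIterate P S q η δ u t)) (WithLp.ofLp (u t))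

/-- The distribution `π_t` of round `t` (rounds are numbered from `0`). -/
def iterate {d k : ℕ} (P : Tensor d k) (S : Set (Fin k → ℝ)) (q : ℝ≥0∞) [Fact (1 ≤ q)]
    (η δ : ℝ) (u : ℕ → EuclideanSpace ℝ (Fin d)) (t : ℕ) : Fin d → ℝ :=
  mirrorStep (dualIterate P S q η δ u t)

/-- The output after `T` rounds: the average of the distributions of rounds `0, …, T - 1`. -/
def output {d k : ℕ} (P : Tensor d k) (S : Set (Fin k → ℝ)) (q : ℝ≥0∞) [Fact (1 ≤ q)]
    (η δ : ℝ) (T : ℕ) (u : ℕ → EuclideanSpace ℝ (Fin d)) : Fin d → ℝ :=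
  (T : ℝ)⁻¹ • ∑ t ∈ Finset.range T, iterate P S q η δ u t

/-- The uniform probability distribution on the Euclidean unit sphere of `ℝᵈ`, as a measure on
`ℝᵈ` (for `d ≥ 1`): the normalized surface measure. -/
def sphereUniform (d : ℕ) : Measure (EuclideanSpace ℝ (Fin d)) :=
  (((volume : Measure (EuclideanSpace ℝ (Fin d))).toSphere Set.univ)⁻¹ •
    (volume : Measure (EuclideanSpace ℝ (Fin d))).toSphere).map Subtype.val

end BlackwellPref

end

/-! The function x ↦ max_i ρ(P(x, i), S) is convex on all of ℝᵈ and agrees with v, because a convex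
function of the opponent's mixture is maximal at a vertex. Entries of P are at most 1 and ‖·‖_q ≤
k^(1/q) ‖·‖_∞, so it is k^(1/q)-Lipschitz in ℓ¹ and L-Lipschitz in ℓ² with L = k^(1/q) √d. The
algorithm is stochastic mirror descent on this function, and three estimates give the rate.

Regret: the log-partition function is a potential that starts at log d and has second-order growth
at most 4‖a‖_∞², so the regret is at most log d / η + 4η ∑ ‖ĝ_t‖_∞² (`regret_le`).

Bias: E ĝ is a subgradient up to an additive error 2Lδ (`sub_le_integral_gradEst`). This is the
divergence theorem on a ball of radius δ combined with convexity (`integral_sphere_inner_le`).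

Variance: E‖ĝ‖_∞² ≤ 300 L² log d (`integral_norm_gradEst_sq_le`). The difference h(u) = f(x + δu) -
f(x - δu) is odd and 2Lδ-Lipschitz, so a Poincaré inequality on the sphere gives E h² of order (Lδ)²
/ d. The factor ‖u‖_∞² is of order log d / d except on an event controlled by the subgaussian tails
of the coordinates. Both sphere facts come from the Gaussian, whose direction is uniform and
independent of its norm.

With an average over T rounds, the expected excess is at most 2Lδ + 1200 η L² log d + log d / (ηT).
The prescribed η and δ make all three terms multiples of k^(1/q) √d log d / √T. -/

noncomputable section

namespace BlackwellPref

open Real Filter Topology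
open scoped NNReal RealInnerProductSpace

/-! ### The uniform law on the sphere as the direction of a Gaussian vector -/

section SphereGaussian

variable {d : ℕ} [NeZero d]

instance : Nonempty (Fin d) := ⟨0⟩

instance : IsProbabilityMeasure (sphereUniform d) := by
  unfold sphereUniform
  have h0 : (volume : Measure (EuclideanSpace ℝ (Fin d))).toSphere Set.univ ≠ 0 := by
    rw [Ne, Measure.measure_univ_eq_zero]
    exact Measure.toSphere_ne_zero _
  have : IsProbabilityMeasure (((volume : Measure (EuclideanSpace ℝ (Fin d))).toSphere Set.univ)⁻¹ •
      (volume : Measure (EuclideanSpace ℝ (Fin d))).toSphere) := by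
    constructor
    rw [Measure.smul_apply, smul_eq_mul, ENNReal.inv_mul_cancel h0 (measure_ne_top _ _)]
  exact Measure.isProbabilityMeasure_map measurable_subtype_coe.aemeasurable

omit [NeZero d] in
theorem ae_norm_eq_one_sphereUniform : ∀ᵐ u ∂(sphereUniform d), ‖u‖ = 1 := by
  unfold sphereUniform
  rw [ae_map_iff measurable_subtype_coe.aemeasurable
    (measurableSet_eq_fun measurable_norm measurable_const)]
  exact Filter.Eventually.of_forall fun u => norm_eq_of_mem_sphere u

omit [NeZero d] in
theorem integral_sphereUniform (a : EuclideanSpace ℝ (Fin d) → ℝ) :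
    ∫ u, a u ∂(sphereUniform d) =
      ((volume : Measure (EuclideanSpace ℝ (Fin d))).toSphere.real Set.univ)⁻¹ *
        ∫ u, a u.1 ∂(volume : Measure (EuclideanSpace ℝ (Fin d))).toSphere := by
  unfold sphereUniform
  rw [(MeasurableEmbedding.subtype_coe Metric.isClosed_sphere.measurableSet).integral_map,
    integral_smul_measure, ENNReal.toReal_inv]
  rfl

/-- Integration in polar coordinates of a product of an angular and a radial function. -/
theorem integral_angular_mul_radial (a : EuclideanSpace ℝ (Fin d) → ℝ) (b : ℝ → ℝ) :
    ∫ v : EuclideanSpace ℝ (Fin d), a (‖v‖⁻¹ • v) * b ‖v‖ =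
      (∫ u, a u ∂(sphereUniform d)) * ∫ v : EuclideanSpace ℝ (Fin d), b ‖v‖ := by
  have key : ∀ a : EuclideanSpace ℝ (Fin d) → ℝ,
      ∫ v : EuclideanSpace ℝ (Fin d), a (‖v‖⁻¹ • v) * b ‖v‖ =
      (∫ u, a u.1 ∂(volume : Measure (EuclideanSpace ℝ (Fin d))).toSphere) *
        ∫ r : Set.Ioi (0 : ℝ), b r
          ∂(Measure.volumeIoiPow (Module.finrank ℝ (EuclideanSpace ℝ (Fin d)) - 1)) := by
    intro a
    calc ∫ v : EuclideanSpace ℝ (Fin d), a (‖v‖⁻¹ • v) * b ‖v‖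
        = ∫ v : ({(0 : EuclideanSpace ℝ (Fin d))}ᶜ : Set _), a (‖v.1‖⁻¹ • v.1) * b ‖v.1‖
            ∂(volume.comap Subtype.val) := by
          rw [integral_subtype_comap (measurableSet_singleton _).compl
            fun v : EuclideanSpace ℝ (Fin d) ↦ a (‖v‖⁻¹ • v) * b ‖v‖,
            restrict_compl_singleton]
      _ = ∫ p : Metric.sphere (0 : EuclideanSpace ℝ (Fin d)) 1 × Set.Ioi (0 : ℝ), a p.1.1 * b p.2
            ∂(volume : Measure (EuclideanSpace ℝ (Fin d))).toSphere.prod (.volumeIoiPow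
              (Module.finrank ℝ (EuclideanSpace ℝ (Fin d)) - 1)) := by
          simpa using (volume : Measure (EuclideanSpace ℝ (Fin
            d))).measurePreserving_homeomorphUnitSphereProd.integral_comp
            (Homeomorph.measurableEmbedding _)
            (fun p : Metric.sphere (0 : EuclideanSpace ℝ (Fin d)) 1 × Set.Ioi (0 : ℝ) =>
              a p.1.1 * b p.2)
      _ = _ := integral_prod_mul (fun u : Metric.sphere (0 : EuclideanSpace ℝ (Fin d)) 1 => a u.1)
            (fun r : Set.Ioi (0 : ℝ) => b r)
  -- The constant angular function identifies the unknown radial factor, so the total sphere area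
  -- cancels.
  have h1 := key fun _ => 1
  simp only [one_mul, integral_const, smul_eq_mul, mul_one] at h1
  have h0 : (volume : Measure (EuclideanSpace ℝ (Fin d))).toSphere.real Set.univ ≠ 0 := by
    rw [Ne, measureReal_eq_zero_iff, Measure.measure_univ_eq_zero]
    exact Measure.toSphere_ne_zero _
  rw [key a, h1, integral_sphereUniform]
  field_simp

omit [NeZero d] in
-- Both measures are finite and have the same characteristic function. The explicit radial density
-- opens the way to polar coordinates and to absolute continuity.
theorem stdGaussian_eq_withDensity :
    stdGaussian (EuclideanSpace ℝ (Fin d)) = volume.withDensity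
      (fun x => ENNReal.ofReal ((2 * π) ^ (-(d : ℝ) / 2) * rexp (-‖x‖ ^ 2 / 2))) := by
  have hint : Integrable (fun x : EuclideanSpace ℝ (Fin d) =>
      (2 * π) ^ (-(d : ℝ) / 2) * rexp (-‖x‖ ^ 2 / 2)) := by
    have := (GaussianFourier.integrable_cexp_neg_mul_sq_norm_add (V := EuclideanSpace ℝ (Fin d))
      (b := 1 / 2) (by norm_num) 0 0).norm
    refine (this.congr (Eventually.of_forall fun x => ?_)).const_mul _
    simp only [Complex.norm_exp]
    congr 1
    simp [← Complex.ofReal_pow]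
    ring
  have : IsFiniteMeasure ((volume : Measure (EuclideanSpace ℝ (Fin d))).withDensity
      (fun x => ENNReal.ofReal ((2 * π) ^ (-(d : ℝ) / 2) * rexp (-‖x‖ ^ 2 / 2)))) :=
    isFiniteMeasure_withDensity_ofReal hint.2
  apply Measure.ext_of_charFun
  ext t
  rw [charFun_stdGaussian, charFun_apply, integral_withDensity_eq_integral_toReal_smul
    (by fun_prop) (by simp)]
  have h := GaussianFourier.integral_cexp_neg_mul_sq_norm_add (V := EuclideanSpace ℝ (Fin d))
    (b := 1 / 2) (by norm_num) Complex.I t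
  have hpos : (0 : ℝ) < 2 * π := by positivity
  calc Complex.exp (-‖t‖ ^ 2 / 2)
      = ((2 * π : ℝ) ^ (-(d : ℝ) / 2) : ℝ) * ∫ v : EuclideanSpace ℝ (Fin d),
        Complex.exp (-(1 / 2 : ℂ) * ‖v‖ ^ 2 + Complex.I * ⟪t, v⟫) := by
        rw [h, show ((π : ℂ) / (1 / 2)) = ((2 * π : ℝ) : ℂ) by push_cast; ring,
          Complex.ofReal_cpow hpos.le, ← mul_assoc, ← Complex.cpow_add _ _ (by exact_mod_cast hpos.ne')]
        simp only [finrank_euclideanSpace, Fintype.card_fin, Complex.I_sq]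
        push_cast
        rw [show -(d : ℂ) / 2 + d / 2 = 0 by ring, Complex.cpow_zero, one_mul]
        congr 1; ring
    _ = _ := by
        rw [← integral_const_mul]
        congr 1 with v
        rw [ENNReal.toReal_ofReal (by positivity), Complex.real_smul, Complex.exp_add]
        push_cast
        rw [mul_assoc]
        congr 2
        · congr 1; ring
        · rw [real_inner_comm]; congr 1; ring

omit [NeZero d] in
theorem integral_stdGaussian (F : EuclideanSpace ℝ (Fin d) → ℝ) :
    ∫ x, F x ∂(stdGaussian (EuclideanSpace ℝ (Fin d))) =
      ∫ x, F x * ((2 * π) ^ (-(d : ℝ) / 2) * rexp (-‖x‖ ^ 2 / 2)) := by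
  rw [stdGaussian_eq_withDensity, integral_withDensity_eq_integral_toReal_smul
    (by fun_prop) (by simp)]
  congr 1 with x
  rw [ENNReal.toReal_ofReal (by positivity), smul_eq_mul, mul_comm]

omit [NeZero d] in
theorem stdGaussian_absolutelyContinuous :
    stdGaussian (EuclideanSpace ℝ (Fin d)) ≪ volume := by
  rw [stdGaussian_eq_withDensity]
  exact withDensity_absolutelyContinuous _ _

/-- Under the standard Gaussian distribution the direction is uniform on the sphere and
independent of the norm. -/
theorem integral_stdGaussian_angular_mul_radial (a : EuclideanSpace ℝ (Fin d) → ℝ) (b : ℝ → ℝ) :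
    ∫ v, a (‖v‖⁻¹ • v) * b ‖v‖ ∂(stdGaussian (EuclideanSpace ℝ (Fin d))) =
      (∫ u, a u ∂(sphereUniform d)) *
        ∫ v, b ‖v‖ ∂(stdGaussian (EuclideanSpace ℝ (Fin d))) := by
  rw [integral_stdGaussian, integral_stdGaussian]
  simp only [mul_assoc]
  exact integral_angular_mul_radial a
    (fun r => b r * ((2 * π) ^ (-(d : ℝ) / 2) * rexp (-r ^ 2 / 2)))

theorem integral_sphereUniform_eq_stdGaussian (a : EuclideanSpace ℝ (Fin d) → ℝ) :
    ∫ u, a u ∂(sphereUniform d) =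
      ∫ v, a (‖v‖⁻¹ • v) ∂(stdGaussian (EuclideanSpace ℝ (Fin d))) := by
  have := integral_stdGaussian_angular_mul_radial a fun _ => 1
  simpa using this.symm

/-- Negation is a linear isometry, hence preserves the Gaussian and commutes with taking directions.
-/
theorem integral_sphereUniform_comp_neg (a : EuclideanSpace ℝ (Fin d) → ℝ) :
    ∫ u, a (-u) ∂(sphereUniform d) = ∫ u, a u ∂(sphereUniform d) := by
  have h := stdGaussian_map (LinearIsometryEquiv.neg ℝ (E := EuclideanSpace ℝ (Fin d)))
  rw [integral_sphereUniform_eq_stdGaussian, integral_sphereUniform_eq_stdGaussian a]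
  conv_rhs => rw [← h]
  have he : MeasurableEmbedding (LinearIsometryEquiv.neg ℝ (E := EuclideanSpace ℝ (Fin d))) :=
    (LinearIsometryEquiv.neg ℝ (E := EuclideanSpace ℝ (Fin d))).toHomeomorph.measurableEmbedding
  rw [he.integral_map]
  simp

omit [NeZero d] in
theorem map_apply_stdGaussian (i : Fin d) :
    (stdGaussian (EuclideanSpace ℝ (Fin d))).map (fun v => v i) = gaussianReal 0 1 := by
  rw [← map_pi_eq_stdGaussian, Measure.map_map (by fun_prop) (by fun_prop)]
  exact (measurePreserving_eval (fun _ : Fin d => gaussianReal 0 1) i).map_eq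

omit [NeZero d] in
theorem integrable_apply_sq_stdGaussian (i : Fin d) :
    Integrable (fun v => v i ^ 2) (stdGaussian (EuclideanSpace ℝ (Fin d))) := by
  have h : Integrable (fun x : ℝ => x ^ 2) (gaussianReal 0 1) :=
    (memLp_id_gaussianReal 2).integrable_sq
  rw [← map_apply_stdGaussian i] at h
  exact h.comp_measurable (by fun_prop)

omit [NeZero d] in
theorem integrable_norm_sq_stdGaussian :
    Integrable (fun v => ‖v‖ ^ 2) (stdGaussian (EuclideanSpace ℝ (Fin d))) := by
  simp_rw [EuclideanSpace.real_norm_sq_eq]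
  exact integrable_finsetSum _ fun i _ => integrable_apply_sq_stdGaussian i

omit [NeZero d] in
theorem integral_norm_sq_stdGaussian :
    ∫ v, ‖v‖ ^ 2 ∂(stdGaussian (EuclideanSpace ℝ (Fin d))) = d := by
  have hL : ∀ i : Fin d, ∫ v, (v i) ^ 2 ∂(stdGaussian (EuclideanSpace ℝ (Fin d))) = 1 := by
    intro i
    have h : ∫ x, x ^ 2 ∂(gaussianReal 0 1) = 1 := by
      have := variance_id_gaussianReal (μ := 0) (v := 1)
      rw [variance_of_integral_eq_zero (by fun_prop) (by simp)] at this
      simpa using this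
    rw [← map_apply_stdGaussian i, integral_map (by fun_prop) (by fun_prop)] at h
    exact h
  simp_rw [EuclideanSpace.real_norm_sq_eq]
  rw [integral_finsetSum _ fun i _ => integrable_apply_sq_stdGaussian i]
  simp [hL]

theorem exp_sq_gaussianReal :
    Integrable (fun x => rexp (x ^ 2 / 4)) (gaussianReal 0 1) ∧
      ∫ x, rexp (x ^ 2 / 4) ∂(gaussianReal 0 1) = √2 := by
  have hpdf : ∀ x : ℝ, gaussianPDFReal 0 1 x * rexp (x ^ 2 / 4) =
      (√(2 * π))⁻¹ * rexp (-(1 / 4) * x ^ 2) := by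
    intro x
    rw [gaussianPDFReal, mul_assoc, ← Real.exp_add]
    congr 2
    · simp
    · simp; ring
  constructor
  · rw [gaussianReal_of_var_ne_zero _ one_ne_zero, gaussianPDF_def,
      integrable_withDensity_iff_integrable_smul' (by fun_prop) (by simp)]
    simp only [ENNReal.toReal_ofReal (gaussianPDFReal_nonneg _ _ _), smul_eq_mul, hpdf]
    exact (integrable_exp_neg_mul_sq (by norm_num)).const_mul _
  · rw [integral_gaussianReal_eq_integral_smul one_ne_zero]
    simp only [smul_eq_mul, hpdf]
    rw [integral_const_mul, integral_gaussian, ← Real.sqrt_inv, ← Real.sqrt_mul (by positivity)]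
    congr 1
    field_simp
    norm_num

/-- Coordinates of a uniform point of the sphere are subgaussian with variance proxy of
order `1 / d`. -/
theorem integral_exp_sq_sphereUniform_le (i : Fin d) :
    ∫ u, rexp (d * u i ^ 2 / 4) ∂(sphereUniform d) ≤ √2 := by
  set γ := stdGaussian (EuclideanSpace ℝ (Fin d)) with hγ
  set a : EuclideanSpace ℝ (Fin d) → ℝ := fun u => rexp (d * u i ^ 2 / 4) with ha
  -- The slope of s ↦ exp(s uᵢ² / 4) at s = d. Since E‖v‖² = d and the direction is independent of
  -- the norm, the tangent-line correction below has mean zero: this is Jensen's inequality in ‖v‖²,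
  -- comparing the sphere with the Gaussian.
  set b : EuclideanSpace ℝ (Fin d) → ℝ := fun u => a u * (u i ^ 2 / 4) with hb
  have hexp := exp_sq_gaussianReal
  rw [← map_apply_stdGaussian i, integral_map (by fun_prop) (by fun_prop)] at hexp
  have hi : Integrable (fun v : EuclideanSpace ℝ (Fin d) => rexp (v i ^ 2 / 4)) γ :=
    hexp.1.comp_measurable (by fun_prop)
  have hcoord : ∀ v : EuclideanSpace ℝ (Fin d), (‖v‖⁻¹ • v) i ^ 2 ≤ 1 := by
    intro v
    have h1 : ‖(‖v‖⁻¹ • v) i‖ ≤ ‖‖v‖⁻¹ • v‖ := PiLp.norm_apply_le _ _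
    have h2 : ‖‖v‖⁻¹ • v‖ ≤ 1 := by
      rw [norm_smul, norm_inv, norm_norm]
      exact inv_mul_le_one
    rw [← sq_abs, ← Real.norm_eq_abs]
    exact pow_le_one₀ (norm_nonneg _) (h1.trans h2)
  have hbd : ∀ v : EuclideanSpace ℝ (Fin d), ‖a (‖v‖⁻¹ • v)‖ ≤ rexp (d / 4) := by
    intro v
    rw [Real.norm_eq_abs, abs_of_pos (Real.exp_pos _), Real.exp_le_exp]
    have := hcoord v
    have h0 : (0 : ℝ) ≤ d := by positivity
    nlinarith
  have hameas : Measurable fun v : EuclideanSpace ℝ (Fin d) => a (‖v‖⁻¹ • v) := by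
    simp only [ha]; fun_prop
  have hbmeas : Measurable fun v : EuclideanSpace ℝ (Fin d) => b (‖v‖⁻¹ • v) := by
    simp only [hb, ha]; fun_prop
  have hia : Integrable (fun v : EuclideanSpace ℝ (Fin d) => a (‖v‖⁻¹ • v)) γ :=
    Integrable.of_bound hameas.aestronglyMeasurable _ (Eventually.of_forall hbd)
  have hib : Integrable (fun v : EuclideanSpace ℝ (Fin d) => b (‖v‖⁻¹ • v) * (‖v‖ ^ 2 - d)) γ := by
    refine Integrable.bdd_mul (c := rexp (d / 4) * 1)
      (integrable_norm_sq_stdGaussian.sub (integrable_const _))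
      hbmeas.aestronglyMeasurable (Eventually.of_forall fun v => ?_)
    simp only [hb, norm_mul]
    refine mul_le_mul (hbd v) ?_ (norm_nonneg _) (Real.exp_pos _).le
    have := hcoord v
    rw [Real.norm_eq_abs, abs_of_nonneg (by positivity)]
    linarith
  calc ∫ u, a u ∂(sphereUniform d)
      = ∫ v, a (‖v‖⁻¹ • v) ∂γ + ∫ v, b (‖v‖⁻¹ • v) * (‖v‖ ^ 2 - d) ∂γ := by
        rw [← integral_sphereUniform_eq_stdGaussian, hγ,
          integral_stdGaussian_angular_mul_radial b (fun r => r ^ 2 - d),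
          integral_sub integrable_norm_sq_stdGaussian (integrable_const _),
          integral_norm_sq_stdGaussian]
        simp
    _ = ∫ v, (a (‖v‖⁻¹ • v) + b (‖v‖⁻¹ • v) * (‖v‖ ^ 2 - d)) ∂γ := (integral_add hia hib).symm
    _ ≤ ∫ v, rexp (v i ^ 2 / 4) ∂γ := by
        refine integral_mono (hia.add hib) hi fun v => ?_
        have hv : v i ^ 2 = ‖v‖ ^ 2 * (‖v‖⁻¹ • v) i ^ 2 := by
          rcases eq_or_ne v 0 with rfl | hv
          · simp
          · have : ‖v‖ ≠ 0 := norm_ne_zero_iff.2 hv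
            simp only [PiLp.smul_apply, smul_eq_mul]
            field_simp
        simp only [hb, ha]
        rw [hv]
        set c := (‖v‖⁻¹ • v) i ^ 2
        have := Real.add_one_le_exp ((‖v‖ ^ 2 - d) * c / 4)
        calc rexp (d * c / 4) + rexp (d * c / 4) * (c / 4) * (‖v‖ ^ 2 - d)
            = rexp (d * c / 4) * ((‖v‖ ^ 2 - d) * c / 4 + 1) := by ring
          _ ≤ rexp (d * c / 4) * rexp ((‖v‖ ^ 2 - d) * c / 4) := by gcongr
          _ = rexp (‖v‖ ^ 2 * c / 4) := by rw [← Real.exp_add]; congr 1; ring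
    _ = √2 := hexp.2

end SphereGaussian

/-! ### A Poincaré inequality for odd functions, by rotating independent Gaussian pairs -/

section GaussianPoincare

variable {E : Type*} [NormedAddCommGroup E] [InnerProductSpace ℝ E] [FiniteDimensional ℝ E]
  [MeasurableSpace E] [BorelSpace E]

theorem integrable_norm_sq_of_isGaussian (γ : Measure E) [IsGaussian γ] :
    Integrable (fun x => ‖x‖ ^ 2) γ :=
  (IsGaussian.memLp_two_id (μ := γ)).norm.integrable_sq

/-- The mean squared increment of `H` along the rotation of angle `s` of two independent standard
Gaussian vectors. -/
def rotationIncrement (H : E → ℝ) (s : ℝ) : ℝ :=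
  ∫ p : E × E, (H (cos s • p.1 + sin s • p.2) - H p.1) ^ 2 ∂((stdGaussian E).prod (stdGaussian E))

theorem integrable_sq_norm_add_norm :
    Integrable (fun p : E × E => (‖p.1‖ + ‖p.2‖) ^ 2) ((stdGaussian E).prod (stdGaussian E)) := by
  have h := integrable_norm_sq_of_isGaussian (stdGaussian E)
  have h1 := h.comp_fst (stdGaussian E)
  have h2 := h.comp_snd (stdGaussian E)
  refine ((h1.add h2).const_mul 2).mono' (by fun_prop) (Eventually.of_forall fun p => ?_)
  rw [Real.norm_eq_abs, abs_of_nonneg (by positivity)]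
  simp only [Pi.add_apply]
  nlinarith [sq_nonneg (‖p.1‖ - ‖p.2‖)]

omit [FiniteDimensional ℝ E] [MeasurableSpace E] [BorelSpace E] in
theorem abs_increment_le {H : E → ℝ} {K : ℝ≥0} (hH : LipschitzWith K H) (s : ℝ) (x y : E) :
    |H (cos s • x + sin s • y) - H x| ≤ K * (|s| * (‖x‖ + ‖y‖)) := by
  have h := hH.dist_le_mul (cos s • x + sin s • y) x
  rw [Real.dist_eq, dist_eq_norm] at h
  refine h.trans (mul_le_mul_of_nonneg_left ?_ K.2)
  have e : cos s • x + sin s • y - x = (cos s - 1) • x + sin s • y := by module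
  rw [e]
  refine (norm_add_le _ _).trans ?_
  rw [norm_smul, norm_smul, mul_add]
  have h1 : |cos s - 1| ≤ |s| := by
    simpa using Real.abs_cos_sub_cos_le s 0
  have h2 : |sin s| ≤ |s| := Real.abs_sin_le_abs
  simp only [Real.norm_eq_abs]
  gcongr

theorem integrable_increment_sq {H : E → ℝ} {K : ℝ≥0} (hH : LipschitzWith K H) (s : ℝ) :
    Integrable (fun p : E × E => (H (cos s • p.1 + sin s • p.2) - H p.1) ^ 2)
      ((stdGaussian E).prod (stdGaussian E)) := by
  have hc := hH.continuous
  refine (integrable_sq_norm_add_norm.const_mul ((K * |s|) ^ 2)).mono' (by fun_prop)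
    (Eventually.of_forall fun p => ?_)
  rw [Real.norm_eq_abs, abs_of_nonneg (by positivity), ← mul_pow, ← sq_abs]
  have := abs_increment_le hH s p.1 p.2
  rw [← mul_assoc] at this
  gcongr

theorem measurePreserving_rotation_stdGaussian (θ : ℝ) :
    MeasurePreserving (ContinuousLinearMap.rotation θ : E × E →L[ℝ] E × E)
      ((stdGaussian E).prod (stdGaussian E)) ((stdGaussian E).prod (stdGaussian E)) :=
  ⟨by fun_prop, IsGaussian.map_rotation_eq_self_of_forall_strongDual_eq_zero
    integral_strongDual_stdGaussian θ⟩

omit [InnerProductSpace ℝ E] [FiniteDimensional ℝ E] [MeasurableSpace E] [BorelSpace E] in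
-- By the addition formulas, the step from angle θ to θ + s is the step from 0 to s taken from the
-- rotated pair. As rotations preserve the product Gaussian, all increments of angle s have the same
-- mean square.
theorem increment_comp_rotation [NormedSpace ℝ E] (H : E → ℝ) (θ s : ℝ) (p : E × E) :
    H (cos (θ + s) • p.1 + sin (θ + s) • p.2) - H (cos θ • p.1 + sin θ • p.2) =
      H (cos s • (ContinuousLinearMap.rotation θ p).1 +
        sin s • (ContinuousLinearMap.rotation θ p).2) - H (ContinuousLinearMap.rotation θ p).1 := by
  simp only [ContinuousLinearMap.rotation_apply, cos_add, sin_add]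
  congr 2
  module

theorem integrable_increment_rotation_sq {H : E → ℝ} {K : ℝ≥0} (hH : LipschitzWith K H)
    (θ s : ℝ) :
    Integrable (fun p : E × E => (H (cos (θ + s) • p.1 + sin (θ + s) • p.2) -
      H (cos θ • p.1 + sin θ • p.2)) ^ 2) ((stdGaussian E).prod (stdGaussian E)) := by
  simp only [increment_comp_rotation H θ s]
  exact (measurePreserving_rotation_stdGaussian θ).integrable_comp_of_integrable
    (integrable_increment_sq hH s)

theorem integral_increment_rotation_sq {H : E → ℝ} {K : ℝ≥0} (hH : LipschitzWith K H) (θ s : ℝ) :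
    ∫ p : E × E, (H (cos (θ + s) • p.1 + sin (θ + s) • p.2) - H (cos θ • p.1 + sin θ • p.2)) ^ 2
      ∂((stdGaussian E).prod (stdGaussian E)) = rotationIncrement H s := by
  have hp := measurePreserving_rotation_stdGaussian (E := E) θ
  have hi := integrable_increment_sq hH s
  rw [← hp.map_eq] at hi
  rw [rotationIncrement]
  conv_rhs => rw [← hp.map_eq]
  rw [integral_map hp.measurable.aemeasurable hi.aestronglyMeasurable]
  simp only [increment_comp_rotation H θ s]

/-- Rademacher's theorem gives differentiability at Gaussian-almost every x, where the rescaled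
increment tends to H'(x) y. For fixed x this is a centred Gaussian in y with variance ‖H'(x)‖² ≤ K².
-/
theorem tendsto_rotationIncrement {H : E → ℝ} {K : ℝ≥0} (hH : LipschitzWith K H)
    (hac : stdGaussian E ≪ volume) :
    ∃ L ≤ (K : ℝ) ^ 2, Tendsto (fun n : ℕ => ((n : ℝ) / π) ^ 2 * rotationIncrement H (π / n))
      atTop (𝓝 L) := by
  set γ := stdGaussian E
  refine ⟨∫ p, (fderiv ℝ H p.1 p.2) ^ 2 ∂(γ.prod γ), ?_, ?_⟩
  · have hb : ∀ x, ∫ y, (fderiv ℝ H x y) ^ 2 ∂γ ≤ (K : ℝ) ^ 2 := by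
      intro x
      have h := variance_dual_stdGaussian (fderiv ℝ H x)
      rw [variance_of_integral_eq_zero (by fun_prop) (integral_strongDual_stdGaussian _)] at h
      rw [h]
      gcongr
      exact norm_fderiv_le_of_lipschitz ℝ hH
    have hm : Measurable fun p : E × E => fderiv ℝ H p.1 p.2 := by
      have h1 : Measurable (fderiv ℝ H) := measurable_fderiv ℝ H
      exact (isBoundedBilinearMap_apply.continuous.measurable).comp
        ((h1.comp measurable_fst).prodMk measurable_snd)
    have hi : Integrable (fun p : E × E => (fderiv ℝ H p.1 p.2) ^ 2) (γ.prod γ) := by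
      refine (integrable_sq_norm_add_norm.const_mul (K ^ 2 : ℝ)).mono'
        (hm.pow_const 2).aestronglyMeasurable (Eventually.of_forall fun p => ?_)
      rw [Real.norm_eq_abs, abs_of_nonneg (by positivity), ← mul_pow, ← sq_abs]
      have h1 := (fderiv ℝ H p.1).le_opNorm p.2
      have h2 : ‖fderiv ℝ H p.1‖ ≤ K := norm_fderiv_le_of_lipschitz ℝ hH
      rw [Real.norm_eq_abs] at h1
      gcongr
      refine h1.trans (mul_le_mul h2 ?_ (norm_nonneg _) K.2)
      linarith [norm_nonneg p.1]
    rw [integral_prod _ hi]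
    calc _ ≤ ∫ _, (K : ℝ) ^ 2 ∂γ := integral_mono hi.integral_prod_left (integrable_const _) hb
      _ = _ := by simp
  · simp only [rotationIncrement, ← integral_const_mul]
    refine tendsto_integral_of_dominated_convergence
      (fun p => (K : ℝ) ^ 2 * (‖p.1‖ + ‖p.2‖) ^ 2) (fun n => ?_)
      (integrable_sq_norm_add_norm.const_mul _) (fun n => ?_) ?_
    · exact (integrable_increment_sq hH _).aestronglyMeasurable.const_mul _
    · refine Eventually.of_forall fun p => ?_
      rw [Real.norm_eq_abs, abs_of_nonneg (by positivity), ← mul_pow, ← mul_pow, ← sq_abs, abs_mul]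
      have := abs_increment_le hH (π / n) p.1 p.2
      have hle : |(n : ℝ) / π| * |π / n| ≤ 1 := by
        rw [← abs_mul, div_mul_div_cancel₀ Real.pi_ne_zero]
        rcases Nat.eq_zero_or_pos n with rfl | hn
        · simp
        · rw [div_self (by exact_mod_cast hn.ne'), abs_one]
      refine pow_le_pow_left₀ (by positivity) ?_ 2
      calc _ ≤ |(n : ℝ) / π| * (K * (|π / n| * (‖p.1‖ + ‖p.2‖))) := by gcongr
        _ = (|(n : ℝ) / π| * |π / n|) * (K * (‖p.1‖ + ‖p.2‖)) := by ring
        _ ≤ 1 * (K * (‖p.1‖ + ‖p.2‖)) := by gcongr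
        _ = _ := one_mul _
    · have hd : ∀ᵐ x ∂γ, DifferentiableAt ℝ H x := hac.ae_le hH.ae_differentiableAt
      have hd' : ∀ᵐ p ∂(γ.prod γ), DifferentiableAt ℝ H p.1 :=
        Measure.quasiMeasurePreserving_fst.ae hd
      filter_upwards [hd'] with p hp
      have hpath : HasDerivAt (fun s : ℝ => cos s • p.1 + sin s • p.2) p.2 0 := by
        have h1 := (Real.hasDerivAt_cos 0).smul_const p.1
        have h2 := (Real.hasDerivAt_sin 0).smul_const p.2
        have h := h1.add h2
        simp only [Real.sin_zero, Real.cos_zero, neg_zero, zero_smul, one_smul, zero_add] at h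
        exact h
      have hF : HasFDerivAt H (fderiv ℝ H p.1) ((fun s : ℝ => cos s • p.1 + sin s • p.2) 0) := by
        simpa using hp.hasFDerivAt
      have hcomp := hF.comp_hasDerivAt (0 : ℝ) hpath
      have hs := hasDerivAt_iff_tendsto_slope.1 hcomp
      have ht : Tendsto (fun n : ℕ => π / (n : ℝ)) atTop (𝓝[≠] 0) := by
        refine tendsto_nhdsWithin_iff.2 ⟨tendsto_const_div_atTop_nhds_zero_nat π, ?_⟩
        filter_upwards [eventually_gt_atTop 0] with n hn
        have : (0 : ℝ) < n := by exact_mod_cast hn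
        simp [Real.pi_ne_zero, hn.ne']
      refine ((hs.comp ht).pow 2).congr fun n => ?_
      simp only [Function.comp, slope_def_field, sub_zero]
      simp
      rw [← mul_pow, div_div_eq_mul_div]
      ring

/-- A Poincaré inequality for odd Lipschitz functions of a standard Gaussian vector. -/
theorem integral_sq_stdGaussian_le {H : E → ℝ} {K : ℝ≥0} (hH : LipschitzWith K H)
    (hodd : ∀ x, H (-x) = -H x) (hac : stdGaussian E ≪ volume) :
    ∫ x, H x ^ 2 ∂(stdGaussian E) ≤ π ^ 2 / 4 * K ^ 2 := by
  set γ := stdGaussian E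
  have hbound : ∀ n : ℕ, 0 < n →
      4 * ∫ x, H x ^ 2 ∂γ ≤ π ^ 2 * (((n : ℝ) / π) ^ 2 * rotationIncrement H (π / n)) := by
    intro n hn
    have hn' : (n : ℝ) ≠ 0 := by exact_mod_cast hn.ne'
    -- A half-turn in n equal steps leads from x to -x, so by oddness the telescoped sum is -2 H x.
    let X : ℕ → E × E → ℝ := fun j p => H (cos (j * (π / n)) • p.1 + sin (j * (π / n)) • p.2)
    have hX : ∀ j p, X (j + 1) p - X j p =
        H (cos (j * (π / n) + π / n) • p.1 + sin (j * (π / n) + π / n) • p.2) -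
          H (cos (j * (π / n)) • p.1 + sin (j * (π / n)) • p.2) := by
      intro j p
      simp only [X]
      push_cast
      rw [add_mul, one_mul]
    have hint : ∀ j, Integrable (fun p => (X (j + 1) p - X j p) ^ 2) (γ.prod γ) := by
      intro j
      simp only [hX]
      exact integrable_increment_rotation_sq hH _ _
    calc 4 * ∫ x, H x ^ 2 ∂γ = ∫ p, (2 * H p.1) ^ 2 ∂(γ.prod γ) := by
          rw [integral_fun_fst (fun x => (2 * H x) ^ 2)]
          simp [mul_pow, integral_const_mul]
          norm_num
      _ = ∫ p, (∑ j ∈ Finset.range n, (X (j + 1) p - X j p)) ^ 2 ∂(γ.prod γ) := by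
          congr 1 with p
          rw [Finset.sum_range_sub (fun j => X j p)]
          have : (n : ℝ) * (π / n) = π := by field_simp
          simp only [X, this]
          simp [hodd]
          ring
      _ ≤ ∫ p, n * ∑ j ∈ Finset.range n, (X (j + 1) p - X j p) ^ 2 ∂(γ.prod γ) := by
          refine integral_mono_of_nonneg (Eventually.of_forall fun p => sq_nonneg _)
            ((integrable_finsetSum _ fun j _ => hint j).const_mul _)
            (Eventually.of_forall fun p => ?_)
          simpa using sq_sum_le_card_mul_sum_sq (s := Finset.range n)
            (f := fun j => X (j + 1) p - X j p)
      _ = n * ∑ j ∈ Finset.range n, rotationIncrement H (π / n) := by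
          rw [integral_const_mul, integral_finsetSum _ fun j _ => hint j]
          simp only [hX]
          simp_rw [γ, integral_increment_rotation_sq hH]
      _ = _ := by
          simp only [Finset.sum_const, Finset.card_range, nsmul_eq_mul]
          field_simp
  obtain ⟨L, hL, hlim⟩ := tendsto_rotationIncrement hH hac
  have := ge_of_tendsto (hlim.const_mul (π ^ 2))
    ((eventually_gt_atTop 0).mono fun n hn => hbound n hn)
  nlinarith [sq_nonneg π]

end GaussianPoincare

/-! ### Second moments of odd Lipschitz functions on the sphere -/

section SphereMoments

theorem norm_norm_smul_sub_le {E : Type*} [NormedAddCommGroup E] [NormedSpace ℝ E] (v w : E) :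
    ‖‖w‖ • (‖v‖⁻¹ • v) - w‖ ≤ 2 * ‖v - w‖ := by
  rcases eq_or_ne v 0 with rfl | hv
  · simp; linarith [norm_nonneg w]
  · have hv' : ‖v‖ ≠ 0 := norm_ne_zero_iff.2 hv
    have e : ‖w‖ • (‖v‖⁻¹ • v) - w = (‖w‖ - ‖v‖) • (‖v‖⁻¹ • v) + (v - w) := by
      rw [sub_smul, smul_inv_smul₀ hv']
      abel
    rw [e]
    refine (norm_add_le _ _).trans ?_
    rw [norm_smul, norm_smul, norm_inv, norm_norm, inv_mul_cancel₀ hv', mul_one, Real.norm_eq_abs]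
    have := abs_norm_sub_norm_le w v
    rw [norm_sub_rev] at this
    linarith

/-- The degree-one homogeneous extension carries the Gaussian inequality to the sphere. Oddness
gives h 0 = 0, so |h| ≤ K on unit vectors and varying the norm costs K; varying the direction costs
2K. -/
theorem lipschitzWith_norm_mul_comp_direction {E : Type*} [NormedAddCommGroup E] [NormedSpace ℝ E]
    {h : E → ℝ} {K : ℝ≥0} (hh : LipschitzWith K h) (hodd : ∀ x, h (-x) = -h x) :
    LipschitzWith (3 * K) fun v => ‖v‖ * h (‖v‖⁻¹ • v) := by
  have h0 : h 0 = 0 := by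
    have := hodd 0
    rw [neg_zero] at this
    linarith
  refine LipschitzWith.of_dist_le_mul fun v w => ?_
  rw [Real.dist_eq, dist_eq_norm]
  push_cast
  have h1 : |h (‖v‖⁻¹ • v)| ≤ K := by
    have := hh.dist_le_mul (‖v‖⁻¹ • v) 0
    rw [h0, Real.dist_eq, dist_eq_norm, sub_zero, sub_zero, norm_smul, norm_inv, norm_norm] at this
    exact this.trans (mul_le_of_le_one_right K.2 inv_mul_le_one)
  have h2 : |h (‖v‖⁻¹ • v) - h (‖w‖⁻¹ • w)| ≤ K * ‖‖v‖⁻¹ • v - ‖w‖⁻¹ • w‖ := by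
    have := hh.dist_le_mul (‖v‖⁻¹ • v) (‖w‖⁻¹ • w)
    rwa [Real.dist_eq, dist_eq_norm] at this
  have h3 : ‖w‖ * ‖‖v‖⁻¹ • v - ‖w‖⁻¹ • w‖ ≤ 2 * ‖v - w‖ := by
    rw [← norm_norm w, ← norm_smul, norm_norm, smul_sub]
    have : ‖w‖ • ‖w‖⁻¹ • w = w := by
      rcases eq_or_ne w 0 with rfl | hw
      · simp
      · exact smul_inv_smul₀ (norm_ne_zero_iff.2 hw) w
    rw [this]
    exact norm_norm_smul_sub_le v w
  calc |‖v‖ * h (‖v‖⁻¹ • v) - ‖w‖ * h (‖w‖⁻¹ • w)|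
      = |(‖v‖ - ‖w‖) * h (‖v‖⁻¹ • v) + ‖w‖ * (h (‖v‖⁻¹ • v) - h (‖w‖⁻¹ • w))| := by
        congr 1; ring
    _ ≤ |‖v‖ - ‖w‖| * |h (‖v‖⁻¹ • v)| + ‖w‖ * |h (‖v‖⁻¹ • v) - h (‖w‖⁻¹ • w)| := by
        refine (abs_add_le _ _).trans ?_
        rw [abs_mul, abs_mul, abs_norm]
    _ ≤ ‖v - w‖ * K + ‖w‖ * (K * ‖‖v‖⁻¹ • v - ‖w‖⁻¹ • w‖) := by
        gcongr
        exact abs_norm_sub_norm_le v w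
    _ = ‖v - w‖ * K + K * (‖w‖ * ‖‖v‖⁻¹ • v - ‖w‖⁻¹ • w‖) := by ring
    _ ≤ ‖v - w‖ * K + K * (2 * ‖v - w‖) := by gcongr
    _ = 3 * K * ‖v - w‖ := by ring

variable {d : ℕ} [NeZero d]

/-- A Poincaré inequality for odd Lipschitz functions on the sphere. -/
theorem integral_sq_sphereUniform_le {h : EuclideanSpace ℝ (Fin d) → ℝ} {K : ℝ≥0}
    (hh : LipschitzWith K h) (hodd : ∀ x, h (-x) = -h x) :
    ∫ u, h u ^ 2 ∂(sphereUniform d) ≤ 9 * π ^ 2 / 4 * K ^ 2 / d := by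
  have hd : (0 : ℝ) < d := by exact_mod_cast Nat.pos_of_ne_zero (NeZero.ne d)
  have h1 := integral_sq_stdGaussian_le (lipschitzWith_norm_mul_comp_direction hh hodd)
    (fun v => by simp [hodd]) stdGaussian_absolutelyContinuous
  -- Independence of norm and direction, with E‖v‖² = d, is the source of the factor 1 / d.
  have h2 : ∫ v, (‖v‖ * h (‖v‖⁻¹ • v)) ^ 2 ∂(stdGaussian (EuclideanSpace ℝ (Fin d))) =
      (∫ u, h u ^ 2 ∂(sphereUniform d)) * d := by
    rw [← integral_norm_sq_stdGaussian,
      ← integral_stdGaussian_angular_mul_radial (fun u => h u ^ 2) (fun r => r ^ 2)]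
    congr 1 with v
    ring
  rw [h2] at h1
  rw [le_div_iff₀ hd]
  refine h1.trans (le_of_eq ?_)
  push_cast
  ring

/-- Here `‖WithLp.ofLp u‖` is the sup norm. The Poincaré bound handles the event where it is
typical; elsewhere h² ≤ K² and a union bound over coordinates suffices. -/
theorem integral_sq_mul_norm_sq_sphereUniform_le (hd : 2 ≤ d)
    {h : EuclideanSpace ℝ (Fin d) → ℝ} {K : ℝ≥0}
    (hh : LipschitzWith K h) (hodd : ∀ x, h (-x) = -h x) :
    ∫ u, h u ^ 2 * ‖WithLp.ofLp u‖ ^ 2 ∂(sphereUniform d) ≤ 300 * K ^ 2 * log d / d ^ 2 := by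
  have hd2 : (2 : ℝ) ≤ d := by exact_mod_cast hd
  have hd0 : (0 : ℝ) < d := by linarith
  have hlog : 1 / 2 ≤ log d := by
    have := Real.log_two_gt_d9
    have := Real.log_le_log (by norm_num) hd2
    linarith
  have h0 : h 0 = 0 := by
    have := hodd 0
    rw [neg_zero] at this
    linarith
  have hc := hh.continuous
  have habs : ∀ u, |h u| ≤ K * ‖u‖ := by
    intro u
    have := hh.dist_le_mul u 0
    rwa [h0, Real.dist_eq, dist_eq_norm, sub_zero, sub_zero] at this
  have hpt : ∀ u : EuclideanSpace ℝ (Fin d), ‖u‖ = 1 → h u ^ 2 * ‖WithLp.ofLp u‖ ^ 2 ≤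
      12 * log d / d * h u ^ 2 + K ^ 2 / d ^ 3 * ∑ i, rexp (d * u i ^ 2 / 4) := by
    intro u hu
    have hK : h u ^ 2 ≤ K ^ 2 := by
      rw [← sq_abs]
      have := habs u
      rw [hu, mul_one] at this
      gcongr
    have hsum : 0 ≤ ∑ i, rexp (d * u i ^ 2 / 4) := Finset.sum_nonneg fun i _ => (exp_pos _).le
    -- Past this threshold some coordinate has d uᵢ² / 4 > 3 log d, so the sum of exponentials is at
    -- least d³. Its mean is at most √2 d, which leaves a contribution √2 K² / d².
    by_cases hM : ‖WithLp.ofLp u‖ ^ 2 ≤ 12 * log d / d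
    · have h1 : h u ^ 2 * ‖WithLp.ofLp u‖ ^ 2 ≤ h u ^ 2 * (12 * log d / d) := by gcongr
      have h2 : 0 ≤ K ^ 2 / d ^ 3 * ∑ i, rexp (d * u i ^ 2 / 4) := by positivity
      linarith
    · push Not at hM
      have hi : ∃ i, 12 * log d / d < u i ^ 2 := by
        by_contra! hcon
        refine hM.not_ge ?_
        rw [← Real.le_sqrt (norm_nonneg _) (by positivity),
          pi_norm_le_iff_of_nonneg (Real.sqrt_nonneg _)]
        exact fun i => Real.abs_le_sqrt (hcon i)
      obtain ⟨i, hi⟩ := hi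
      have hM1 : ‖WithLp.ofLp u‖ ^ 2 ≤ 1 := by
        refine pow_le_one₀ (norm_nonneg _) ?_
        rw [pi_norm_le_iff_of_nonneg zero_le_one]
        exact fun i => hu ▸ PiLp.norm_apply_le u i
      have hexp : (d : ℝ) ^ 3 ≤ ∑ i, rexp (d * u i ^ 2 / 4) := by
        refine le_trans ?_ (Finset.single_le_sum (f := fun i => rexp (d * u i ^ 2 / 4))
          (fun i _ => (exp_pos _).le) (Finset.mem_univ i))
        rw [div_lt_iff₀ hd0] at hi
        rw [← Real.exp_log (show (0 : ℝ) < d ^ 3 by positivity), Real.log_pow, Real.exp_le_exp]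
        push_cast
        linarith
      calc h u ^ 2 * ‖WithLp.ofLp u‖ ^ 2 ≤ (K : ℝ) ^ 2 * 1 := by gcongr
        _ = (K : ℝ) ^ 2 / d ^ 3 * d ^ 3 := by field_simp
        _ ≤ K ^ 2 / d ^ 3 * ∑ i, rexp (d * u i ^ 2 / 4) := by gcongr
        _ ≤ _ := le_add_of_nonneg_left (by positivity)
  have hsq : Integrable (fun u => h u ^ 2) (sphereUniform d) := by
    refine Integrable.of_bound (by fun_prop) (K ^ 2 : ℝ) ?_
    filter_upwards [ae_norm_eq_one_sphereUniform] with u hu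
    have := habs u
    rw [hu, mul_one] at this
    rw [Real.norm_eq_abs, abs_pow]
    gcongr
  have hexp : ∀ i : Fin d, Integrable (fun u : EuclideanSpace ℝ (Fin d) => rexp (d * u i ^ 2 / 4))
      (sphereUniform d) := by
    intro i
    refine Integrable.of_bound (by fun_prop) (rexp (d / 4)) ?_
    filter_upwards [ae_norm_eq_one_sphereUniform] with u hu
    have h1 : ‖u i‖ ≤ 1 := hu ▸ PiLp.norm_apply_le u i
    have h2 : u i ^ 2 ≤ 1 := by
      rw [← sq_abs, ← Real.norm_eq_abs]
      exact pow_le_one₀ (norm_nonneg _) h1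
    rw [Real.norm_eq_abs, abs_of_pos (exp_pos _), Real.exp_le_exp]
    nlinarith
  have hR : Integrable (fun u => 12 * log d / d * h u ^ 2 +
      K ^ 2 / d ^ 3 * ∑ i, rexp (d * u i ^ 2 / 4)) (sphereUniform d) :=
    (hsq.const_mul _).add ((integrable_finsetSum _ fun i _ => hexp i).const_mul _)
  calc ∫ u, h u ^ 2 * ‖WithLp.ofLp u‖ ^ 2 ∂(sphereUniform d)
      ≤ ∫ u, (12 * log d / d * h u ^ 2 + K ^ 2 / d ^ 3 * ∑ i, rexp (d * u i ^ 2 / 4))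
          ∂(sphereUniform d) := by
        refine integral_mono_of_nonneg (Eventually.of_forall fun u => by positivity) hR ?_
        filter_upwards [ae_norm_eq_one_sphereUniform] with u hu using hpt u hu
    _ = 12 * log d / d * ∫ u, h u ^ 2 ∂(sphereUniform d) +
        K ^ 2 / d ^ 3 * ∑ i, ∫ u, rexp (d * u i ^ 2 / 4) ∂(sphereUniform d) := by
        rw [integral_add (hsq.const_mul _) ((integrable_finsetSum _ fun i _ => hexp i).const_mul _),
          integral_const_mul, integral_const_mul, integral_finsetSum _ fun i _ => hexp i]
    _ ≤ 12 * log d / d * (9 * π ^ 2 / 4 * K ^ 2 / d) + K ^ 2 / d ^ 3 * ∑ _i : Fin d, √2 := by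
        gcongr with i
        · exact integral_sq_sphereUniform_le hh hodd
        · exact integral_exp_sq_sphereUniform_le i
    _ = (27 * π ^ 2 * log d + √2) * (K ^ 2 / d ^ 2) := by
        simp
        field_simp
        ring
    _ ≤ (300 * log d) * (K ^ 2 / d ^ 2) := by
        gcongr
        have h1 : √2 ≤ 2 := by
          rw [Real.sqrt_le_left (by norm_num)]
          norm_num
        have h2 : π ^ 2 ≤ 10 := by
          have := Real.pi_lt_d2
          have := Real.pi_pos
          nlinarith
        nlinarith
    _ = _ := by ring

end SphereMoments

/-! ### Spherical averages as approximate subgradients -/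

section SphericalGradient

variable {E : Type*} [NormedAddCommGroup E] [InnerProductSpace ℝ E]

/-- The radial cutoff that is `1` for `‖v‖ ≤ δ`, vanishes for `‖v‖ ≥ δ + ε`, and is affine in `‖v‖`
in between. -/
def radialCutoff (δ ε : ℝ) (v : E) : ℝ := max 0 (min 1 ((δ + ε - ‖v‖) / ε))

omit [InnerProductSpace ℝ E] in
theorem radialCutoff_nonneg (δ ε : ℝ) (v : E) : 0 ≤ radialCutoff δ ε v := le_max_left _ _

omit [InnerProductSpace ℝ E] in
theorem radialCutoff_le_one (δ ε : ℝ) (v : E) : radialCutoff δ ε v ≤ 1 :=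
  max_le zero_le_one (min_le_left _ _)

omit [InnerProductSpace ℝ E] in
theorem radialCutoff_of_le {δ ε : ℝ} (hε : 0 < ε) {v : E} (hv : ‖v‖ ≤ δ) :
    radialCutoff δ ε v = 1 := by
  have : 1 ≤ (δ + ε - ‖v‖) / ε := by rw [le_div_iff₀ hε]; linarith
  rw [radialCutoff, min_eq_left this, max_eq_right zero_le_one]

omit [InnerProductSpace ℝ E] in
theorem radialCutoff_of_ge {δ ε : ℝ} (hε : 0 < ε) {v : E} (hv : δ + ε ≤ ‖v‖) :
    radialCutoff δ ε v = 0 := by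
  have : (δ + ε - ‖v‖) / ε ≤ 0 := div_nonpos_of_nonpos_of_nonneg (by linarith) hε.le
  rw [radialCutoff, max_eq_left ((min_le_right _ _).trans this)]

omit [InnerProductSpace ℝ E] in
theorem radialCutoff_of_mem_Ioo {δ ε : ℝ} (hε : 0 < ε) {v : E} (h1 : δ < ‖v‖)
    (h2 : ‖v‖ < δ + ε) : radialCutoff δ ε v = (δ + ε - ‖v‖) / ε := by
  have h3 : (δ + ε - ‖v‖) / ε ≤ 1 := by rw [div_le_iff₀ hε]; linarith
  have h4 : 0 ≤ (δ + ε - ‖v‖) / ε := div_nonneg (by linarith) hε.le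
  rw [radialCutoff, min_eq_right h3, max_eq_right h4]

omit [InnerProductSpace ℝ E] in
theorem lipschitzWith_radialCutoff {δ ε : ℝ} (hε : 0 < ε) :
    LipschitzWith (ε⁻¹).toNNReal (radialCutoff δ ε : E → ℝ) := by
  refine LipschitzWith.const_max (LipschitzWith.const_min ?_ 1) 0
  refine LipschitzWith.of_dist_le_mul fun v w => ?_
  rw [Real.coe_toNNReal _ (inv_nonneg.2 hε.le), Real.dist_eq, dist_eq_norm, ← sub_div, abs_div,
    abs_of_pos hε, div_eq_inv_mul]
  gcongr
  have := abs_norm_sub_norm_le w v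
  rw [norm_sub_rev] at this
  rwa [show δ + ε - ‖v‖ - (δ + ε - ‖w‖) = ‖w‖ - ‖v‖ by ring]

theorem hasCompactSupport_radialCutoff [FiniteDimensional ℝ E] {δ ε : ℝ} (hε : 0 < ε) :
    HasCompactSupport (radialCutoff δ ε : E → ℝ) := by
  refine HasCompactSupport.intro (isCompact_closedBall 0 (δ + ε)) fun v hv => ?_
  rw [mem_closedBall_zero_iff, not_le] at hv
  exact radialCutoff_of_ge hε hv.le

theorem lineDeriv_radialCutoff_of_mem_Ioo {δ ε : ℝ} (hδ : 0 < δ) (hε : 0 < ε) {v : E}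
    (h1 : δ < ‖v‖) (h2 : ‖v‖ < δ + ε) (w : E) :
    lineDeriv ℝ (radialCutoff δ ε) v (-w) = ε⁻¹ * ⟪‖v‖⁻¹ • v, w⟫ := by
  have hc : Continuous fun t : ℝ => v + t • -w := by fun_prop
  have hev : ∀ᶠ t in 𝓝 (0 : ℝ), radialCutoff δ ε (v + t • -w) = (δ + ε - ‖v + t • -w‖) / ε := by
    have ho : IsOpen {t : ℝ | δ < ‖v + t • -w‖ ∧ ‖v + t • -w‖ < δ + ε} :=
      (isOpen_lt continuous_const hc.norm).inter (isOpen_lt hc.norm continuous_const)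
    filter_upwards [ho.mem_nhds (by simp [h1, h2])] with t ht
    exact radialCutoff_of_mem_Ioo hε ht.1 ht.2
  have hp : HasDerivAt (fun t : ℝ => v + t • -w) (-w) 0 := by
    simpa using ((hasDerivAt_id (0 : ℝ)).smul_const (-w)).const_add v
  have hv : 0 < ‖v‖ := hδ.trans h1
  have hn : HasDerivAt (fun t : ℝ => ‖v + t • -w‖) (⟪v, -w⟫ / ‖v‖) 0 := by
    have h := hp.norm_sq.sqrt (by simpa using hv.ne')
    simp only [Real.sqrt_sq (norm_nonneg _), zero_smul, add_zero] at h
    convert h using 1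
    field_simp
  refine (HasDerivAt.congr_of_eventuallyEq ((hn.const_sub (δ + ε)).div_const ε) hev).deriv.trans ?_
  rw [inner_neg_right, real_inner_smul_left]
  field_simp

theorem lineDeriv_radialCutoff_of_lt {δ ε : ℝ} (hε : 0 < ε) {v : E} (h1 : ‖v‖ < δ) (w : E) :
    lineDeriv ℝ (radialCutoff δ ε) v w = 0 := by
  have hc : Continuous fun t : ℝ => v + t • w := by fun_prop
  have hev : (fun t : ℝ => radialCutoff δ ε (v + t • w)) =ᶠ[𝓝 0] fun _ => 1 := by
    filter_upwards [(isOpen_lt hc.norm (continuous_const (y := δ))).mem_nhds (by simpa using h1)]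
      with t ht
    exact radialCutoff_of_le hε (le_of_lt ht)
  rw [lineDeriv, hev.deriv_eq, deriv_const]

theorem lineDeriv_radialCutoff_of_gt {δ ε : ℝ} (hε : 0 < ε) {v : E} (h1 : δ + ε < ‖v‖) (w : E) :
    lineDeriv ℝ (radialCutoff δ ε) v w = 0 := by
  have hc : Continuous fun t : ℝ => v + t • w := by fun_prop
  have hev : (fun t : ℝ => radialCutoff δ ε (v + t • w)) =ᶠ[𝓝 0] fun _ => 0 := by
    filter_upwards [(isOpen_lt (continuous_const (y := δ + ε)) hc.norm).mem_nhds
      (by simpa using h1)] with t ht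
    exact radialCutoff_of_ge hε (le_of_lt ht)
  rw [lineDeriv, hev.deriv_eq, deriv_const]

/-- Along the line, the derivative at 0 is at most the slope of the chord over [0, 1]. -/
theorem lineDeriv_le_sub_of_convexOn {f : E → ℝ} (hf : ConvexOn ℝ Set.univ f) {v w : E}
    (hd : LineDifferentiableAt ℝ f v w) : lineDeriv ℝ f v w ≤ f (v + w) - f v := by
  have hg : ConvexOn ℝ Set.univ fun t : ℝ => f (v + t • w) := by
    have := hf.comp_affineMap (AffineMap.lineMap v (v + w))
    refine this.congr fun t _ => ?_
    simp [AffineMap.lineMap_apply, add_comm]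
  have h := hg.le_slope_of_hasDerivAt (Set.mem_univ 0) (Set.mem_univ 1) one_pos hd.hasLineDerivAt
  simpa [slope_def_field] using h

variable {d : ℕ} [NeZero d]

/-- For a convex Lipschitz `f`, the spherical average of `(d / δ) f(x + δ u) u` is an approximate
subgradient of `f` at `x`. -/
theorem integral_sphere_inner_le {f : EuclideanSpace ℝ (Fin d) → ℝ} {G : ℝ≥0}
    (hf : LipschitzWith G f) (hconv : ConvexOn ℝ Set.univ f) {δ : ℝ} (hδ : 0 < δ)
    (x y : EuclideanSpace ℝ (Fin d)) :
    d / δ * ∫ u, ⟪u, y - x⟫ * f (x + δ • u) ∂(sphereUniform d) ≤ f y - f x + 2 * G * δ := by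
  set w := y - x with hw
  set m := ∫ u, ⟪u, w⟫ * f (x + δ • u) ∂(sphereUniform d) with hm
  set V := (volume : Measure (EuclideanSpace ℝ (Fin d))).real (Metric.ball 0 1) with hV
  have hVpos : 0 < V := by
    rw [hV, measureReal_def]
    exact ENNReal.toReal_pos (Metric.measure_ball_pos _ _ one_pos).ne' measure_ball_lt_top.ne
  set N : ℝ → ℝ := fun r => V * r ^ d with hN
  set A : ℝ → ℝ := fun ε => f y - f x + 2 * G * (δ + ε) with hA
  -- A divergence theorem without boundary integrals: integrate by parts against the cutoff, whose
  -- derivative lives on a shell of width ε. N r is the volume of the r-ball; the terms with ‖w‖ G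
  -- and |A ε| are errors proportional to the shell volume. A ε may be negative, hence the absolute
  -- value.
  have key : ∀ ε > 0, (N (δ + ε) - N δ) / ε * m - ‖w‖ * G * (N (δ + ε) - N δ) ≤
      A ε * N δ + |A ε| * (N (δ + ε) - N δ) := by
    intro ε hε
    set f' : EuclideanSpace ℝ (Fin d) → ℝ := fun v => f (x + v) with hf'
    set φ : EuclideanSpace ℝ (Fin d) → ℝ := radialCutoff δ ε with hφ
    set S : Set (EuclideanSpace ℝ (Fin d)) := Metric.ball 0 (δ + ε) \ Metric.closedBall 0 δ with hS
    have hSm : MeasurableSet S := Metric.isOpen_ball.measurableSet.diff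
      Metric.isClosed_closedBall.measurableSet
    have hmemS : ∀ v, v ∈ S ↔ δ < ‖v‖ ∧ ‖v‖ < δ + ε := by
      intro v
      simp [hS, and_comm]
    have hball : ∀ r > 0, volume.real (Metric.ball (0 : EuclideanSpace ℝ (Fin d)) r) = N r := by
      intro r hr
      rw [measureReal_def, Measure.addHaar_ball _ _ hr.le, ENNReal.toReal_mul,
        ENNReal.toReal_ofReal (by positivity), mul_comm]
      simp [hN, hV, measureReal_def]
    have hcball : ∀ r > 0, volume.real (Metric.closedBall (0 : EuclideanSpace ℝ (Fin d)) r) =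
        N r := by
      intro r hr
      rw [← hball r hr, Measure.addHaar_real_closedBall_eq_addHaar_real_ball]
    have hvolS : volume.real S = N (δ + ε) - N δ := by
      rw [hS, measureReal_sdiff (Metric.closedBall_subset_ball (by linarith))
        Metric.isClosed_closedBall.measurableSet, hball _ (by linarith), hcball _ hδ]
    have hSfin : volume S ≠ ∞ := ((measure_mono Set.sdiff_subset).trans_lt measure_ball_lt_top).ne
    have hf'lip : LipschitzWith G f' := by
      refine LipschitzWith.of_dist_le_mul fun v w => ?_
      simpa using hf.dist_le_mul (x + v) (x + w)
    have hf'conv : ConvexOn ℝ Set.univ f' := by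
      have := hconv.translate_right x
      simpa [hf', Function.comp_def] using this
    have hφlip : LipschitzWith _ φ := lipschitzWith_radialCutoff hε
    have hφcs : HasCompactSupport φ := hasCompactSupport_radialCutoff hε
    have hφint : Integrable φ := hφlip.continuous.integrable_of_hasCompactSupport hφcs
    have hibp := hf'lip.integral_lineDeriv_mul_eq (μ := volume) hφlip hφcs w
    -- upper bound from convexity
    have hup : ∫ v, lineDeriv ℝ f' v w * φ v ≤ A ε * N δ + |A ε| * (N (δ + ε) - N δ) := by
      have hi1 : Integrable fun v => lineDeriv ℝ f' v w * φ v := by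
        refine hφint.bdd_mul (c := G * ‖w‖)
          (aestronglyMeasurable_lineDeriv hf'lip.continuous _) ?_
        exact Eventually.of_forall fun v => norm_lineDeriv_le_of_lipschitz ℝ hf'lip
      have h1 : ∫ v, lineDeriv ℝ f' v w * φ v ≤ ∫ v, A ε * φ v := by
        refine integral_mono_ae hi1 (hφint.const_mul _) ?_
        filter_upwards [hf'lip.ae_lineDifferentiableAt (μ := volume) w] with v hv
        rcases le_or_gt (δ + ε) ‖v‖ with h | h
        · simp [hφ, radialCutoff_of_ge hε h]
        · refine mul_le_mul_of_nonneg_right ?_ (radialCutoff_nonneg _ _ _)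
          refine (lineDeriv_le_sub_of_convexOn hf'conv hv).trans ?_
          have e : f' (v + w) = f (y + v) := by simp only [hf', hw]; congr 1; abel
          rw [e]
          have h2 := (abs_le.1 ((Real.dist_eq _ _).symm.trans_le (hf.dist_le_mul (y + v) y))).2
          have h3 := (abs_le.1 ((Real.dist_eq _ _).symm.trans_le (hf.dist_le_mul (x + v) x))).1
          simp only [dist_eq_norm, add_sub_cancel_left] at h2 h3
          have h4 : (G : ℝ) * ‖v‖ ≤ G * (δ + ε) := by gcongr
          simp only [hA, hf']
          linarith
      have h2 : N δ ≤ ∫ v, φ v := by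
        rw [← hcball δ hδ, ← integral_indicator_one Metric.isClosed_closedBall.measurableSet]
        refine integral_mono_of_nonneg (Eventually.of_forall fun v => ?_) hφint
          (Eventually.of_forall fun v => ?_)
        · exact Set.indicator_nonneg (fun _ _ => zero_le_one) v
        · refine Set.indicator_le' (g := φ) (fun v hv => ?_) (fun v _ => radialCutoff_nonneg _ _ _) v
          simpa using (radialCutoff_of_le hε (mem_closedBall_zero_iff.1 hv)).ge
      have h3 : ∫ v, φ v ≤ N (δ + ε) := by
        rw [← hball (δ + ε) (by linarith),
          ← integral_indicator_one Metric.isOpen_ball.measurableSet]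
        refine integral_mono_of_nonneg (Eventually.of_forall fun v => radialCutoff_nonneg _ _ _)
          ((integrable_indicator_iff Metric.isOpen_ball.measurableSet).2
            (integrableOn_const measure_ball_lt_top.ne)) (Eventually.of_forall fun v => ?_)
        by_cases hv : v ∈ Metric.ball (0 : EuclideanSpace ℝ (Fin d)) (δ + ε)
        · simpa [Set.indicator_of_mem hv] using radialCutoff_le_one _ _ _
        · rw [Set.indicator_of_notMem hv]
          rw [mem_ball_zero_iff, not_lt] at hv
          exact (radialCutoff_of_ge hε hv).le
      rw [integral_const_mul] at h1
      have h4 : A ε * ((∫ v, φ v) - N δ) ≤ |A ε| * (N (δ + ε) - N δ) := by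
        refine (mul_le_mul_of_nonneg_right (le_abs_self _) (by linarith)).trans ?_
        gcongr
      linarith
    -- the boundary term
    have hlow : (N (δ + ε) - N δ) / ε * m - ‖w‖ * G * (N (δ + ε) - N δ) ≤
        ∫ v, lineDeriv ℝ φ v (-w) * f' v := by
      -- The kinks of the cutoff lie on two spheres, which are null.
      have hsph : ∀ r : ℝ, r ≠ 0 → ∀ᵐ v : EuclideanSpace ℝ (Fin d), ‖v‖ ≠ r := by
        intro r hr
        have := Measure.addHaar_sphere (volume : Measure (EuclideanSpace ℝ (Fin d))) 0 r
        rw [measure_eq_zero_iff_ae_notMem] at this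
        filter_upwards [this] with v hv
        simpa using hv
      have e1 : ∫ v, lineDeriv ℝ φ v (-w) * f' v =
          ∫ v in S, ε⁻¹ * ⟪‖v‖⁻¹ • v, w⟫ * f' v := by
        rw [← integral_indicator hSm]
        refine integral_congr_ae ?_
        filter_upwards [hsph δ hδ.ne', hsph (δ + ε) (by linarith)] with v hv1 hv2
        by_cases hv : v ∈ S
        · rw [Set.indicator_of_mem hv]
          rw [hmemS] at hv
          rw [lineDeriv_radialCutoff_of_mem_Ioo hδ hε hv.1 hv.2]
        · rw [Set.indicator_of_notMem hv]
          rw [hmemS, not_and_or, not_lt, not_lt] at hv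
          rcases hv with hv | hv
          · rw [lineDeriv_radialCutoff_of_lt hε (lt_of_le_of_ne hv hv1), zero_mul]
          · rw [lineDeriv_radialCutoff_of_gt hε (lt_of_le_of_ne hv hv2.symm), zero_mul]
      -- The same shell integral with f' frozen at radius δ; polar coordinates evaluate it exactly,
      -- and the Lipschitz bound makes the replacement cost at most ‖w‖ G times the shell volume.
      have e2 : (N (δ + ε) - N δ) / ε * m =
          ∫ v in S, ε⁻¹ * ⟪‖v‖⁻¹ • v, w⟫ * f' (δ • (‖v‖⁻¹ • v)) := by
        have h := integral_angular_mul_radial (d := d)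
          (fun u => ε⁻¹ * ⟪u, w⟫ * f' (δ • u)) ((Set.Ioo δ (δ + ε)).indicator 1)
        have hind : ∀ v : EuclideanSpace ℝ (Fin d),
            (Set.Ioo δ (δ + ε)).indicator (1 : ℝ → ℝ) ‖v‖ = S.indicator 1 v := by
          intro v
          by_cases hv : v ∈ S
          · simp [hv, (hmemS v).1 hv]
          · have := mt (hmemS v).2 hv
            simp [hv, this]
        simp only [hind] at h
        rw [integral_indicator_one hSm, hvolS] at h
        rw [← integral_indicator hSm]
        simp only [mul_assoc] at h ⊢
        rw [integral_const_mul, integral_const_mul, mul_assoc] at h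
        rw [show (N (δ + ε) - N δ) / ε * m = ε⁻¹ * (m * (N (δ + ε) - N δ)) by ring, hm, ← h,
          ← integral_const_mul]
        congr 1 with v
        by_cases hv : v ∈ S <;> simp [hv]
      have hcont : Continuous f' := hf'lip.continuous
      have hdir : ∀ v : EuclideanSpace ℝ (Fin d), |⟪‖v‖⁻¹ • v, w⟫| ≤ ‖w‖ := by
        intro v
        refine (abs_real_inner_le_norm _ _).trans (mul_le_of_le_one_left (norm_nonneg _) ?_)
        rw [norm_smul, norm_inv, norm_norm]
        exact inv_mul_le_one
      have hbd : ∀ v : EuclideanSpace ℝ (Fin d), ‖v‖ ≤ δ + ε → |f' v| ≤ |f x| + G * (δ + ε) := by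
        intro v hv
        have h1 := hf'lip.dist_le_mul v 0
        rw [Real.dist_eq, dist_eq_norm, sub_zero] at h1
        have h2 : (G : ℝ) * ‖v‖ ≤ G * (δ + ε) := by gcongr
        have h3 : f' 0 = f x := by simp [hf']
        have h4 := abs_sub_abs_le_abs_sub (f' v) (f' 0)
        rw [h3] at h1 h4
        linarith
      have hnorm : ∀ v : EuclideanSpace ℝ (Fin d), ‖δ • (‖v‖⁻¹ • v)‖ ≤ δ + ε := by
        intro v
        rw [norm_smul, norm_smul, norm_inv, norm_norm, Real.norm_eq_abs, abs_of_pos hδ]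
        exact (mul_le_of_le_one_right hδ.le inv_mul_le_one).trans (by linarith)
      have hint : ∀ g : EuclideanSpace ℝ (Fin d) → ℝ, Measurable g →
          (∀ v ∈ S, |g v| ≤ |f x| + G * (δ + ε)) →
          IntegrableOn (fun v => ε⁻¹ * ⟪‖v‖⁻¹ • v, w⟫ * g v) S := by
        intro g hg hgb
        refine Measure.integrableOn_of_bounded (M := ε⁻¹ * ‖w‖ * (|f x| + G * (δ + ε))) hSfin
          (by fun_prop) ?_
        refine (ae_restrict_iff' hSm).2 (Eventually.of_forall fun v hv => ?_)
        rw [norm_mul, norm_mul, Real.norm_eq_abs, Real.norm_eq_abs, Real.norm_eq_abs,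
          abs_of_pos (inv_pos.2 hε)]
        gcongr
        · exact hdir v
        · exact hgb v hv
      have hint1 := hint f' hcont.measurable fun v hv => hbd v ((hmemS v).1 hv).2.le
      have hint2 := hint (fun v => f' (δ • (‖v‖⁻¹ • v))) (by fun_prop) fun v _ => hbd _ (hnorm v)
      rw [e1, e2, ← hvolS]
      have e3 : ‖w‖ * G * volume.real S = ∫ v in S, ‖w‖ * (G : ℝ) := by
        rw [setIntegral_const, smul_eq_mul, mul_comm]
      rw [e3, ← integral_sub hint2 (integrableOn_const hSfin)]
      refine setIntegral_mono_on (hint2.sub (integrableOn_const hSfin)) hint1 hSm fun v hv => ?_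
      rw [hmemS] at hv
      have hv0 : 0 < ‖v‖ := hδ.trans hv.1
      have h1 : |f' (δ • (‖v‖⁻¹ • v)) - f' v| ≤ G * ε := by
        have h := hf'lip.dist_le_mul (δ • (‖v‖⁻¹ • v)) v
        rw [Real.dist_eq, dist_eq_norm] at h
        refine h.trans (mul_le_mul_of_nonneg_left ?_ G.2)
        have e : δ • (‖v‖⁻¹ • v) - v = (δ - ‖v‖) • (‖v‖⁻¹ • v) := by
          rw [sub_smul, smul_inv_smul₀ hv0.ne']
        rw [e, norm_smul, norm_smul, norm_inv, norm_norm, inv_mul_cancel₀ hv0.ne', mul_one,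
          Real.norm_eq_abs, abs_sub_comm, abs_of_pos (by linarith)]
        linarith
      have h2 : ε⁻¹ * ⟪‖v‖⁻¹ • v, w⟫ * (f' (δ • (‖v‖⁻¹ • v)) - f' v) ≤ ‖w‖ * G := by
        refine (le_abs_self _).trans ?_
        rw [abs_mul, abs_mul, abs_of_pos (inv_pos.2 hε)]
        calc _ ≤ ε⁻¹ * ‖w‖ * (G * ε) := by gcongr; exact hdir v
          _ = _ := by field_simp
      linarith
    exact hlow.trans (hibp ▸ hup)
  have hNd : HasDerivAt N (V * (d * δ ^ (d - 1))) δ := (hasDerivAt_pow d δ).const_mul V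
  have hslope : Tendsto (fun ε => (N (δ + ε) - N δ) / ε) (𝓝[>] 0)
      (𝓝 (V * (d * δ ^ (d - 1)))) := by
    have := hNd.tendsto_slope_zero_right
    refine this.congr fun ε => ?_
    rw [smul_eq_mul, div_eq_inv_mul]
  have hNc : Tendsto (fun ε => N (δ + ε) - N δ) (𝓝[>] 0) (𝓝 0) := by
    have hc : Continuous fun ε => N (δ + ε) - N δ := by simp only [hN]; fun_prop
    have := (hc.tendsto 0).mono_left (nhdsWithin_le_nhds (s := Set.Ioi 0))
    simpa using this
  have hAc : Tendsto A (𝓝[>] 0) (𝓝 (f y - f x + 2 * G * δ)) := by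
    have hc : Continuous A := by simp only [hA]; fun_prop
    have := (hc.tendsto 0).mono_left (nhdsWithin_le_nhds (s := Set.Ioi 0))
    simpa [hA] using this
  -- As ε → 0 this becomes N'(δ) m ≤ (f y - f x + 2Gδ) N(δ), and N'(δ) / N(δ) = d / δ.
  have hlim := le_of_tendsto_of_tendsto ((hslope.mul_const m).sub (hNc.const_mul (‖w‖ * G)))
    ((hAc.mul_const (N δ)).add (hAc.abs.mul hNc)) (eventually_mem_nhdsWithin.mono key)
  simp only [mul_zero, sub_zero, add_zero, hN] at hlim
  have hdpos : d ≠ 0 := NeZero.ne d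
  have hpow : δ ^ d = δ ^ (d - 1) * δ := by
    rw [← pow_succ, Nat.sub_add_cancel (Nat.pos_of_ne_zero hdpos)]
  rw [hpow] at hlim
  have hc : 0 < V * δ ^ (d - 1) := by positivity
  have h5 : V * δ ^ (d - 1) * (d * m) ≤ V * δ ^ (d - 1) * ((f y - f x + 2 * G * δ) * δ) := by
    linarith
  have h6 := le_of_mul_le_mul_left h5 hc
  rw [div_mul_eq_mul_div, div_le_iff₀ hδ]
  exact h6

end SphericalGradient

/-! ### Convexity and Lipschitz continuity of the objective -/

section Objective

theorem convexOn_infDist {E : Type*} [SeminormedAddCommGroup E] [NormedSpace ℝ E] {s : Set E}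
    (hs : Convex ℝ s) (hne : s.Nonempty) : ConvexOn ℝ Set.univ fun x => Metric.infDist x s := by
  refine ⟨convex_univ, fun x _ y _ a b ha hb hab => ?_⟩
  refine le_of_forall_pos_le_add fun ε hε => ?_
  obtain ⟨x', hx', hx⟩ := (Metric.infDist_lt_iff hne).1 (lt_add_of_pos_right (Metric.infDist x s) hε)
  obtain ⟨y', hy', hy⟩ := (Metric.infDist_lt_iff hne).1 (lt_add_of_pos_right (Metric.infDist y s) hε)
  refine (Metric.infDist_le_dist_of_mem (hs hx' hy' ha hb hab)).trans ?_
  rw [dist_eq_norm] at hx hy ⊢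
  have e : a • x + b • y - (a • x' + b • y') = a • (x - x') + b • (y - y') := by module
  rw [e]
  refine (norm_add_le _ _).trans ?_
  rw [norm_smul, norm_smul, Real.norm_of_nonneg ha, Real.norm_of_nonneg hb]
  simp only [smul_eq_mul]
  calc a * ‖x - x'‖ + b * ‖y - y'‖ ≤ a * (Metric.infDist x s + ε) + b * (Metric.infDist y s + ε) := by
        gcongr
    _ = a * Metric.infDist x s + b * Metric.infDist y s + (a + b) * ε := by ring
    _ = _ := by rw [hab, one_mul]

variable {d k : ℕ} (P : Tensor d k) (S : Set (Fin k → ℝ)) (q : ℝ≥0∞) [Fact (1 ≤ q)]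

variable {S} in
theorem convexOn_lqDist (hS : Convex ℝ S) (hne : S.Nonempty) :
    ConvexOn ℝ Set.univ fun z => lqDist q z S := by
  have hS' : Convex ℝ (WithLp.toLp q '' S) :=
    hS.linear_image (WithLp.linearEquiv q ℝ (Fin k → ℝ)).symm.toLinearMap
  exact (convexOn_infDist hS' (hne.image _)).comp_linearMap
    (WithLp.linearEquiv q ℝ (Fin k → ℝ)).symm.toLinearMap

/-- The distance to a set is 1-Lipschitz and the q-norm is at most k^(1/q) times the sup norm. For q
= ∞, `q.toReal = 0` and division by zero gives exponent 0, which agrees with 1/∞ = 0. -/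
theorem abs_lqDist_sub_le (z z' : Fin k → ℝ) :
    |lqDist q z S - lqDist q z' S| ≤ (k : ℝ) ^ (1 / q.toReal) * ‖z - z'‖ := by
  have h1 : |lqDist q z S - lqDist q z' S| ≤ dist (WithLp.toLp q z) (WithLp.toLp q z') :=
    Metric.lipschitz_infDist_pt _ |>.dist_le_mul (WithLp.toLp q z) (WithLp.toLp q z') |>.trans
      (by simp)
  have h2 := (PiLp.lipschitzWith_toLp q (fun _ : Fin k => ℝ)).dist_le_mul z z'
  refine h1.trans (h2.trans (le_of_eq ?_))
  rw [dist_eq_norm]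
  simp [NNReal.coe_rpow, ENNReal.toReal_inv]

theorem score_single (x : Fin d → ℝ) (i : Fin d) (j : Fin k) :
    score P x (Pi.single i 1) j = ∑ i₁, x i₁ * P i₁ i j := by
  simp [score, Pi.single_apply]

theorem score_eq_sum (x y : Fin d → ℝ) :
    score P x y = ∑ i, y i • score P x (Pi.single i 1) := by
  ext j
  simp only [Finset.sum_apply, Pi.smul_apply, score_single, smul_eq_mul, Finset.mul_sum]
  rw [score, Finset.sum_comm]
  exact Finset.sum_congr rfl fun i _ => Finset.sum_congr rfl fun i₁ _ => by ring

/-- `x ↦ P(x, i)` as a linear map. -/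
def scoreLinear (i : Fin d) : (Fin d → ℝ) →ₗ[ℝ] (Fin k → ℝ) where
  toFun x := score P x (Pi.single i 1)
  map_add' x y := by
    ext j
    simp [score_single, add_mul, Finset.sum_add_distrib]
  map_smul' c x := by
    ext j
    simp [score_single, Finset.mul_sum, mul_assoc]

theorem lqDist_le_queryValue (x : Fin d → ℝ) (i : Fin d) :
    lqDist q (score P x (Pi.single i 1)) S ≤ queryValue P S q x :=
  le_ciSup (f := fun i => lqDist q (score P x (Pi.single i 1)) S) (Set.finite_range _).bddAbove i

variable {P S} in
theorem convexOn_queryValue [NeZero d] (hS : Convex ℝ S) (hne : S.Nonempty) :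
    ConvexOn ℝ Set.univ (queryValue P S q) := by
  refine ⟨convex_univ, fun x _ y _ a b ha hb hab => ciSup_le fun i => ?_⟩
  have h := ((convexOn_lqDist q hS hne).comp_linearMap (scoreLinear P i)).2
    (Set.mem_univ x) (Set.mem_univ y) ha hb hab
  refine h.trans ?_
  simp only [smul_eq_mul, Function.comp]
  gcongr
  · exact lqDist_le_queryValue P S q x i
  · exact lqDist_le_queryValue P S q y i

variable {P S} in
-- The score is linear in the opponent's mixture and the distance to a convex set is convex, so
-- Jensen's inequality reduces the supremum to pure objects.
theorem value_eq_queryValue [NeZero d] (hS : Convex ℝ S) (hne : S.Nonempty) (x : Fin d → ℝ) :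
    value P S q x = queryValue P S q x := by
  have hle : ∀ y : stdSimplex ℝ (Fin d), lqDist q (score P x y) S ≤ queryValue P S q x := by
    intro y
    rw [score_eq_sum]
    refine ((convexOn_lqDist q hS hne).map_sum_le (fun i _ => y.2.1 i) y.2.2
      fun i _ => Set.mem_univ _).trans ?_
    calc ∑ i, y.1 i • lqDist q (score P x (Pi.single i 1)) S
        ≤ ∑ i, y.1 i • queryValue P S q x := by
          refine Finset.sum_le_sum fun i _ => ?_
          exact smul_le_smul_of_nonneg_left (lqDist_le_queryValue P S q x i) (y.2.1 i)
      _ = _ := by rw [← Finset.sum_smul, y.2.2, one_smul]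
  have : Nonempty (stdSimplex ℝ (Fin d)) := ⟨⟨_, single_mem_stdSimplex ℝ 0⟩⟩
  refine le_antisymm (ciSup_le hle) (ciSup_le fun i => ?_)
  exact le_ciSup (f := fun y : stdSimplex ℝ (Fin d) => lqDist q (score P x y) S)
    ⟨_, by rintro _ ⟨y, rfl⟩; exact hle y⟩ ⟨_, single_mem_stdSimplex ℝ i⟩

variable {P} in
theorem queryValue_le_add [NeZero d] (hP : P ∈ preferenceTensors d k) (x x' : Fin d → ℝ) :
    queryValue P S q x ≤ queryValue P S q x' + (k : ℝ) ^ (1 / q.toReal) * ∑ i, |x i - x' i| := by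
  refine ciSup_le fun i => ?_
  have h1 := (abs_le.1 (abs_lqDist_sub_le S q (score P x (Pi.single i 1))
    (score P x' (Pi.single i 1)))).2
  have h2 := lqDist_le_queryValue P S q x' i
  have h3 : ‖score P x (Pi.single i 1) - score P x' (Pi.single i 1)‖ ≤ ∑ i, |x i - x' i| := by
    rw [pi_norm_le_iff_of_nonneg (Finset.sum_nonneg fun i _ => abs_nonneg _)]
    intro j
    rw [Pi.sub_apply, score_single, score_single, ← Finset.sum_sub_distrib]
    refine (norm_sum_le _ _).trans (Finset.sum_le_sum fun i₁ _ => ?_)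
    have h := hP.1 i₁ i j
    rw [← sub_mul, norm_mul, Real.norm_eq_abs, Real.norm_eq_abs, abs_of_nonneg h.1]
    exact mul_le_of_le_one_right (abs_nonneg _) h.2
  have h4 : (k : ℝ) ^ (1 / q.toReal) * ‖score P x (Pi.single i 1) - score P x' (Pi.single i 1)‖ ≤
      (k : ℝ) ^ (1 / q.toReal) * ∑ i, |x i - x' i| := by gcongr
  linarith

theorem sum_abs_le_sqrt_mul_norm (v : EuclideanSpace ℝ (Fin d)) :
    ∑ i, |v i| ≤ √d * ‖v‖ := by
  rw [EuclideanSpace.norm_eq, ← Real.sqrt_mul (by positivity)]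
  refine Real.le_sqrt_of_sq_le ?_
  simpa using sq_sum_le_card_mul_sum_sq (s := Finset.univ) (f := fun i => |v i|)

variable {P} in
theorem lipschitzWith_queryValue [NeZero d] (hP : P ∈ preferenceTensors d k) :
    LipschitzWith ((k : ℝ) ^ (1 / q.toReal) * √d).toNNReal
      fun v : EuclideanSpace ℝ (Fin d) => queryValue P S q (WithLp.ofLp v) := by
  refine LipschitzWith.of_le_add_mul _ fun v w => ?_
  rw [Real.coe_toNNReal _ (by positivity), dist_eq_norm, mul_assoc]
  refine (queryValue_le_add S q hP (WithLp.ofLp v) (WithLp.ofLp w)).trans ?_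
  gcongr
  exact sum_abs_le_sqrt_mul_norm (v - w)

variable {P} in
theorem continuous_queryValue [NeZero d] (hP : P ∈ preferenceTensors d k) :
    Continuous (queryValue P S q) :=
  (lipschitzWith_queryValue S q hP).continuous.comp (PiLp.continuous_toLp 2 _)

end Objective

/-! ### Entropic mirror descent and its regret -/

section MirrorDescent

variable {d : ℕ}

/-- The log-partition function `log ∑ exp θ_i`, the convex conjugate of the negative entropy. -/
def logPartition (θ : Fin d → ℝ) : ℝ := log (∑ i, rexp (θ i))

/-- The Gibbs distribution with weights proportional to `exp θ_i`. -/
def softmax (θ : Fin d → ℝ) : Fin d → ℝ := fun i => rexp (θ i) / ∑ j, rexp (θ j)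

theorem continuous_softmax [NeZero d] : Continuous (softmax : (Fin d → ℝ) → Fin d → ℝ) := by
  unfold softmax
  refine continuous_pi fun i => Continuous.div (by fun_prop) (by fun_prop) fun θ => ?_
  exact (Finset.sum_pos (fun _ _ => exp_pos _) Finset.univ_nonempty).ne'

variable [NeZero d]

theorem sum_exp_pos (θ : Fin d → ℝ) : 0 < ∑ j, rexp (θ j) :=
  Finset.sum_pos (fun _ _ => exp_pos _) Finset.univ_nonempty

theorem softmax_pos (θ : Fin d → ℝ) (i : Fin d) : 0 < softmax θ i :=
  div_pos (exp_pos _) (sum_exp_pos θ)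

theorem sum_softmax (θ : Fin d → ℝ) : ∑ i, softmax θ i = 1 := by
  unfold softmax
  rw [← Finset.sum_div, div_self (sum_exp_pos θ).ne']

theorem softmax_mem_stdSimplex (θ : Fin d → ℝ) : softmax θ ∈ stdSimplex ℝ (Fin d) :=
  ⟨fun i => (softmax_pos θ i).le, sum_softmax θ⟩

theorem log_softmax (θ : Fin d → ℝ) (i : Fin d) : log (softmax θ i) = θ i - logPartition θ := by
  rw [softmax, log_div (exp_pos _).ne' (sum_exp_pos θ).ne', log_exp, logPartition]

/-- The mirror step of the negative entropy is the Gibbs distribution. -/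
theorem mirrorStep_eq_softmax (θ : Fin d → ℝ) : mirrorStep θ = softmax θ := by
  obtain ⟨hx, hmax⟩ := isMirrorStep_mirrorStep (Nat.pos_of_ne_zero (NeZero.ne d)) θ
  set x := mirrorStep θ
  set p := softmax θ
  -- The objective is the log-partition function minus the relative entropy of y with respect to p.
  -- Strictness of log t ≤ t - 1 makes p the only maximizer, so the choice made by
  -- `Classical.epsilon` is forced and continuous in θ.
  have hobj : ∀ y ∈ stdSimplex ℝ (Fin d), ∑ i, θ i * y i - negEntropy y =
      logPartition θ + ∑ i, y i * (log (p i) - log (y i)) := by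
    intro y hy
    have h1 : logPartition θ = ∑ i, y i * logPartition θ := by
      rw [← Finset.sum_mul, hy.2, one_mul]
    rw [h1, negEntropy, ← Finset.sum_sub_distrib, ← Finset.sum_add_distrib]
    refine Finset.sum_congr rfl fun i _ => ?_
    rw [log_softmax]
    ring
  have hge := isMaxOn_iff.1 hmax _ (softmax_mem_stdSimplex θ)
  rw [hobj _ (softmax_mem_stdSimplex θ), hobj _ hx] at hge
  have hterm : ∀ i, x i * (log (p i) - log (x i)) ≤ p i - x i ∧
      (x i ≠ p i → x i * (log (p i) - log (x i)) < p i - x i) := by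
    intro i
    have hp : 0 < p i := softmax_pos θ i
    rcases (hx.1 i).eq_or_lt with h0 | h0
    · rw [← h0]
      simp [hp.le, hp]
    · rw [← log_div hp.ne' h0.ne']
      have e : p i - x i = x i * (p i / x i - 1) := by field_simp
      rw [e]
      refine ⟨?_, fun hne => ?_⟩
      · gcongr
        exact log_le_sub_one_of_pos (div_pos hp h0)
      · refine mul_lt_mul_of_pos_left (log_lt_sub_one_of_pos (div_pos hp h0) ?_) h0
        rw [Ne, div_eq_one_iff_eq h0.ne']
        exact Ne.symm hne
  by_contra hne
  obtain ⟨i, hi⟩ := Function.ne_iff.1 hne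
  have hlt : ∑ i, x i * (log (p i) - log (x i)) < ∑ i, (p i - x i) :=
    Finset.sum_lt_sum (fun i _ => (hterm i).1) ⟨i, Finset.mem_univ i, (hterm i).2 hi⟩
  rw [Finset.sum_sub_distrib, sum_softmax, hx.2] at hlt
  change logPartition θ + ∑ i, p i * (log (p i) - log (p i)) ≤ _ at hge
  simp only [sub_self, mul_zero, Finset.sum_const_zero, add_zero] at hge
  linarith

omit [NeZero d] in
-- Averaging this over a centred bounded variable removes the linear term and leaves a subgaussian
-- bound.
theorem exp_le_add_exp_sq (x : ℝ) : rexp x ≤ x + rexp (x ^ 2) := by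
  have h1 := add_one_le_exp (x ^ 2)
  rcases le_or_gt |x| 1 with h | h
  · have := (abs_le.1 (abs_exp_sub_one_sub_id_le h)).2
    linarith
  · rcases lt_abs.1 h with h | h
    · have : rexp x ≤ rexp (x ^ 2) := exp_le_exp.2 (by nlinarith)
      linarith
    · have : rexp x ≤ 1 := exp_le_one_iff.2 (by linarith)
      nlinarith

/-- The increment of the log-partition function is the cumulant generating function of a under the
Gibbs law. After centring, |aᵢ - m| ≤ 2‖a‖_∞, whose square gives the constant 4. -/
theorem logPartition_add_le (θ a : Fin d → ℝ) :
    logPartition (θ + a) ≤ logPartition θ + ∑ i, softmax θ i * a i + 4 * ‖a‖ ^ 2 := by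
  set p := softmax θ
  set m := ∑ i, p i * a i with hm
  have habs : ∀ i, |a i| ≤ ‖a‖ := fun i => norm_le_pi_norm a i
  have hmabs : |m| ≤ ‖a‖ := by
    calc |m| ≤ ∑ i, |p i * a i| := Finset.abs_sum_le_sum_abs _ _
      _ ≤ ∑ i, p i * ‖a‖ := by
          refine Finset.sum_le_sum fun i _ => ?_
          rw [abs_mul, abs_of_pos (softmax_pos θ i)]
          exact mul_le_mul_of_nonneg_left (habs i) (softmax_pos θ i).le
      _ = ‖a‖ := by rw [← Finset.sum_mul, sum_softmax, one_mul]
  have hexp : ∑ i, p i * rexp (a i - m) ≤ rexp (4 * ‖a‖ ^ 2) := by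
    calc ∑ i, p i * rexp (a i - m) ≤ ∑ i, p i * ((a i - m) + rexp (4 * ‖a‖ ^ 2)) := by
          refine Finset.sum_le_sum fun i _ =>
            mul_le_mul_of_nonneg_left ?_ (softmax_pos θ i).le
          refine (exp_le_add_exp_sq _).trans ?_
          gcongr
          have h1 : |a i - m| ≤ 2 * ‖a‖ := (abs_sub _ _).trans (by linarith [habs i])
          calc (a i - m) ^ 2 = |a i - m| ^ 2 := (sq_abs _).symm
            _ ≤ (2 * ‖a‖) ^ 2 := by gcongr
            _ = _ := by ring
      _ = (∑ i, p i * a i - (∑ i, p i) * m) + (∑ i, p i) * rexp (4 * ‖a‖ ^ 2) := by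
          simp only [mul_add, mul_sub, Finset.sum_add_distrib, Finset.sum_sub_distrib,
            Finset.sum_mul]
      _ = _ := by rw [sum_softmax, one_mul, one_mul, ← hm, sub_self, zero_add]
  have hZ : ∑ i, rexp ((θ + a) i) = (∑ i, rexp (θ i)) * (rexp m * ∑ i, p i * rexp (a i - m)) := by
    rw [Finset.mul_sum, Finset.mul_sum]
    refine Finset.sum_congr rfl fun i _ => ?_
    have h1 : rexp (θ i) = (∑ j, rexp (θ j)) * p i := by
      simp only [p, softmax]
      rw [mul_div_cancel₀ _ (sum_exp_pos θ).ne']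
    have h2 : rexp ((θ + a) i) = rexp (θ i) * (rexp m * rexp (a i - m)) := by
      rw [← exp_add, ← exp_add, Pi.add_apply]
      congr 1; ring
    rw [h2, h1]
    ring
  have hpos : 0 < ∑ i, p i * rexp (a i - m) :=
    Finset.sum_pos (fun i _ => mul_pos (softmax_pos θ i) (exp_pos _)) Finset.univ_nonempty
  rw [logPartition, hZ, log_mul (sum_exp_pos θ).ne' (by positivity),
    log_mul (exp_pos _).ne' hpos.ne', log_exp, logPartition, add_assoc]
  gcongr
  rw [← log_exp (4 * ‖a‖ ^ 2)]
  exact log_le_log hpos hexp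

theorem sum_mul_le_logPartition (θ : Fin d → ℝ) {p : Fin d → ℝ}
    (hp : p ∈ stdSimplex ℝ (Fin d)) : ∑ i, θ i * p i ≤ logPartition θ := by
  calc ∑ i, θ i * p i ≤ ∑ i, logPartition θ * p i := by
        refine Finset.sum_le_sum fun i _ => mul_le_mul_of_nonneg_right ?_ (hp.1 i)
        rw [logPartition, ← log_exp (θ i), log_exp (θ i)]
        rw [le_log_iff_exp_le (sum_exp_pos θ)]
        exact Finset.single_le_sum (f := fun i => rexp (θ i)) (fun j _ => (exp_pos _).le)
          (Finset.mem_univ i)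
    _ = logPartition θ := by rw [← Finset.mul_sum, hp.2, mul_one]

/-- The regret bound of mirror descent with the negative entropy. -/
theorem regret_le {θ g : ℕ → Fin d → ℝ} {η : ℝ} (h0 : θ 0 = 0)
    (hstep : ∀ t, θ (t + 1) = θ t - η • g t) {p : Fin d → ℝ}
    (hp : p ∈ stdSimplex ℝ (Fin d)) (T : ℕ) :
    η * ∑ t ∈ Finset.range T, ∑ i, g t i * (softmax (θ t) i - p i) ≤
      log d + 4 * η ^ 2 * ∑ t ∈ Finset.range T, ‖g t‖ ^ 2 := by
  -- The potential is log d at θ = 0, and at the end it dominates ⟨θ_T, p⟩ = -η ∑ ⟨g_t, p⟩, which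
  -- brings in the comparator.
  have hpot : ∀ T, logPartition (θ T) + η * ∑ t ∈ Finset.range T, ∑ i, g t i * softmax (θ t) i ≤
      log d + 4 * η ^ 2 * ∑ t ∈ Finset.range T, ‖g t‖ ^ 2 := by
    intro T
    induction T with
    | zero => simp [h0, logPartition]
    | succ T ih =>
      have h := logPartition_add_le (θ T) (-(η • g T))
      rw [← sub_eq_add_neg, ← hstep, norm_neg, norm_smul, mul_pow, Real.norm_eq_abs, sq_abs] at h
      have e : ∑ i, softmax (θ T) i * (-(η • g T)) i = -(η * ∑ i, g T i * softmax (θ T) i) := by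
        rw [Finset.mul_sum, ← Finset.sum_neg_distrib]
        refine Finset.sum_congr rfl fun i _ => ?_
        simp only [Pi.neg_apply, Pi.smul_apply, smul_eq_mul]
        ring
      rw [e] at h
      rw [Finset.sum_range_succ, Finset.sum_range_succ]
      linarith
  have hθ : ∀ T i, θ T i = -(η * ∑ t ∈ Finset.range T, g t i) := by
    intro T i
    induction T with
    | zero => simp [h0]
    | succ T ih =>
      rw [hstep, Pi.sub_apply, ih, Finset.sum_range_succ, Pi.smul_apply, smul_eq_mul]
      ring
  have h1 := sum_mul_le_logPartition (θ T) hp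
  have e : ∑ i, θ T i * p i = -(η * ∑ t ∈ Finset.range T, ∑ i, g t i * p i) := by
    simp only [hθ]
    rw [Finset.sum_comm, Finset.mul_sum, ← Finset.sum_neg_distrib]
    refine Finset.sum_congr rfl fun i _ => ?_
    rw [neg_mul, mul_assoc, Finset.sum_mul]
  rw [e] at h1
  have h2 := hpot T
  simp only [mul_sub, Finset.sum_sub_distrib]
  linarith

end MirrorDescent

/-! ### Bias and variance of the two-point gradient estimate -/

section OneStep

variable {d k : ℕ} [NeZero d] {P : Tensor d k} {S : Set (Fin k → ℝ)} {q : ℝ≥0∞} [Fact (1 ≤ q)]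

theorem integrable_sphereUniform_of_continuous {F : EuclideanSpace ℝ (Fin d) → ℝ}
    (hF : Continuous F) : Integrable F (sphereUniform d) := by
  obtain ⟨C, hC⟩ := (isCompact_sphere (0 : EuclideanSpace ℝ (Fin d)) 1).exists_bound_of_continuousOn
    hF.continuousOn
  refine Integrable.of_bound hF.aestronglyMeasurable C ?_
  filter_upwards [ae_norm_eq_one_sphereUniform] with u hu
  exact hC u (mem_sphere_zero_iff_norm.2 hu)

theorem continuous_gradEst (hP : P ∈ preferenceTensors d k) (δ : ℝ) :
    Continuous fun z : (Fin d → ℝ) × (Fin d → ℝ) => gradEst P S q δ z.1 z.2 := by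
  have hc := continuous_queryValue S q hP
  unfold gradEst
  fun_prop

/-- The first moment of the two-point estimate is an approximate subgradient. -/
theorem sub_le_integral_gradEst (hP : P ∈ preferenceTensors d k) (hS : Convex ℝ S)
    (hne : S.Nonempty) {δ : ℝ} (hδ : 0 < δ) (x y : Fin d → ℝ) :
    queryValue P S q x - queryValue P S q y - 2 * ((k : ℝ) ^ (1 / q.toReal) * √d) * δ ≤
      ∫ u, ∑ i, gradEst P S q δ x (WithLp.ofLp u) i * (x i - y i) ∂(sphereUniform d) := by
  set f : EuclideanSpace ℝ (Fin d) → ℝ := fun v => queryValue P S q (WithLp.ofLp v) with hf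
  have hlip : LipschitzWith _ f := lipschitzWith_queryValue S q hP
  have hconv : ConvexOn ℝ Set.univ f := (convexOn_queryValue q hS hne).comp_linearMap
    (WithLp.linearEquiv 2 ℝ (Fin d → ℝ)).toLinearMap
  have hc : Continuous f := hlip.continuous
  set X : EuclideanSpace ℝ (Fin d) := WithLp.toLp 2 x
  set Y : EuclideanSpace ℝ (Fin d) := WithLp.toLp 2 y
  have h := integral_sphere_inner_le hlip hconv hδ X Y
  rw [Real.coe_toNNReal _ (by positivity)] at h
  set m := ∫ u, ⟪u, Y - X⟫ * f (X + δ • u) ∂(sphereUniform d) with hm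
  -- Reflecting u shows that both halves of the symmetric difference contribute equally, so the
  -- factor d / (2δ) becomes d / δ.
  have hm' : ∫ u, ⟪u, Y - X⟫ * f (X - δ • u) ∂(sphereUniform d) = -m := by
    rw [← integral_sphereUniform_comp_neg, hm, ← integral_neg]
    congr 1 with u
    rw [inner_neg_left, smul_neg, sub_neg_eq_add, neg_mul]
  have hi1 : Integrable (fun u => ⟪u, Y - X⟫ * f (X + δ • u)) (sphereUniform d) :=
    integrable_sphereUniform_of_continuous (by fun_prop)
  have hi2 : Integrable (fun u => ⟪u, Y - X⟫ * f (X - δ • u)) (sphereUniform d) :=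
    integrable_sphereUniform_of_continuous (by fun_prop)
  have e : ∫ u, ∑ i, gradEst P S q δ x (WithLp.ofLp u) i * (x i - y i) ∂(sphereUniform d) =
      -(d / δ * m) := by
    calc _ = ∫ u, -(d / (2 * δ)) * (⟪u, Y - X⟫ * f (X + δ • u) - ⟪u, Y - X⟫ * f (X - δ • u))
          ∂(sphereUniform d) := by
          congr 1 with u
          have e1 : ∑ i, u i * (x i - y i) = -⟪u, Y - X⟫ := by
            rw [PiLp.inner_apply, ← Finset.sum_neg_distrib]
            refine Finset.sum_congr rfl fun i _ => ?_
            simp only [X, Y, PiLp.sub_apply, RCLike.inner_apply, conj_trivial]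
            ring
          have e2 : ∀ i, gradEst P S q δ x (WithLp.ofLp u) i * (x i - y i) =
              d / (2 * δ) * (f (X + δ • u) - f (X - δ • u)) * (u i * (x i - y i)) := by
            intro i
            simp only [gradEst, Pi.smul_apply, smul_eq_mul, mul_assoc]
            rfl
          simp only [e2]
          rw [← Finset.mul_sum, e1]
          ring
      _ = _ := by
          rw [integral_const_mul, integral_sub hi1 hi2, hm', ← hm]
          field_simp
          ring
  rw [e]
  change _ ≤ queryValue P S q y - queryValue P S q x + _ at h
  linarith

/-- The second moment of the two-point estimate in the sup norm. -/
theorem integral_norm_gradEst_sq_le (hd : 2 ≤ d) (hP : P ∈ preferenceTensors d k) {δ : ℝ}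
    (hδ : 0 < δ) (x : Fin d → ℝ) :
    ∫ u, ‖gradEst P S q δ x (WithLp.ofLp u)‖ ^ 2 ∂(sphereUniform d) ≤
      300 * ((k : ℝ) ^ (1 / q.toReal) * √d) ^ 2 * log d := by
  set f : EuclideanSpace ℝ (Fin d) → ℝ := fun v => queryValue P S q (WithLp.ofLp v) with hf
  set X : EuclideanSpace ℝ (Fin d) := WithLp.toLp 2 x
  set L : ℝ := (k : ℝ) ^ (1 / q.toReal) * √d with hL
  have hL0 : 0 ≤ L := by positivity
  have hlip : LipschitzWith L.toNNReal f := lipschitzWith_queryValue S q hP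
  set h : EuclideanSpace ℝ (Fin d) → ℝ := fun u => f (X + δ • u) - f (X - δ • u) with hh
  -- The δ² in the square of this constant cancels the 1 / δ² of the estimate, so the variance bound
  -- is free of δ.
  have hhlip : LipschitzWith (2 * L * δ).toNNReal h := by
    refine LipschitzWith.of_dist_le_mul fun u v => ?_
    have h1 := hlip.dist_le_mul (X + δ • u) (X + δ • v)
    have h2 := hlip.dist_le_mul (X - δ • u) (X - δ • v)
    rw [dist_add_left, dist_smul₀, Real.norm_of_nonneg hδ.le, Real.coe_toNNReal _ hL0,
      Real.dist_eq] at h1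
    rw [dist_sub_left, dist_smul₀, Real.norm_of_nonneg hδ.le, Real.coe_toNNReal _ hL0,
      Real.dist_eq] at h2
    rw [Real.coe_toNNReal _ (by positivity), Real.dist_eq]
    calc |h u - h v| = |(f (X + δ • u) - f (X + δ • v)) - (f (X - δ • u) - f (X - δ • v))| := by
          simp only [hh]; congr 1; ring
      _ ≤ _ := (abs_sub _ _).trans (add_le_add h1 h2)
      _ = _ := by ring
  have hodd : ∀ u, h (-u) = -h u := by
    intro u
    simp only [hh, smul_neg, sub_neg_eq_add, ← sub_eq_add_neg]
    ring
  have hd0 : (0 : ℝ) < d := by exact_mod_cast Nat.pos_of_ne_zero (NeZero.ne d)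
  have hmain := integral_sq_mul_norm_sq_sphereUniform_le hd hhlip hodd
  rw [Real.coe_toNNReal _ (by positivity)] at hmain
  have e : ∀ u : EuclideanSpace ℝ (Fin d), ‖gradEst P S q δ x (WithLp.ofLp u)‖ ^ 2 =
      (d / (2 * δ)) ^ 2 * (h u ^ 2 * ‖WithLp.ofLp u‖ ^ 2) := by
    intro u
    rw [gradEst, norm_smul, mul_pow, Real.norm_eq_abs, sq_abs, mul_pow, mul_assoc]
    rfl
  simp only [e]
  rw [integral_const_mul]
  refine (mul_le_mul_of_nonneg_left hmain (by positivity)).trans (le_of_eq ?_)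
  field_simp

/-- The excess of the suboptimality gap of `x` over its linearization by the gradient estimate,
corrected by the second-order term of the regret bound. -/
def linearizationGap (P : Tensor d k) (S : Set (Fin k → ℝ)) (q : ℝ≥0∞) [Fact (1 ≤ q)]
    (η δ : ℝ) (y x : Fin d → ℝ) (u : EuclideanSpace ℝ (Fin d)) : ℝ :=
  queryValue P S q x - queryValue P S q y -
    ∑ i, gradEst P S q δ x (WithLp.ofLp u) i * (x i - y i) +
    4 * η * ‖gradEst P S q δ x (WithLp.ofLp u)‖ ^ 2

theorem continuous_linearizationGap (hP : P ∈ preferenceTensors d k) (η δ : ℝ) (y : Fin d → ℝ) :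
    Continuous fun z : (Fin d → ℝ) × EuclideanSpace ℝ (Fin d) =>
      linearizationGap P S q η δ y z.1 z.2 := by
  have hc := continuous_queryValue S q hP
  have hg : Continuous fun z : (Fin d → ℝ) × EuclideanSpace ℝ (Fin d) =>
      gradEst P S q δ z.1 (WithLp.ofLp z.2) :=
    (continuous_gradEst hP δ).comp (g := fun z : (Fin d → ℝ) × (Fin d → ℝ) =>
      gradEst P S q δ z.1 z.2) (f := fun z : (Fin d → ℝ) × EuclideanSpace ℝ (Fin d) =>
      (z.1, WithLp.ofLp z.2)) (by fun_prop)
  have hgi : ∀ i, Continuous fun z : (Fin d → ℝ) × EuclideanSpace ℝ (Fin d) =>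
      gradEst P S q δ z.1 (WithLp.ofLp z.2) i := fun i => (continuous_apply i).comp hg
  unfold linearizationGap
  fun_prop

theorem integral_linearizationGap_le (hd : 2 ≤ d) (hP : P ∈ preferenceTensors d k)
    (hS : Convex ℝ S) (hne : S.Nonempty) {η δ : ℝ} (hη : 0 ≤ η) (hδ : 0 < δ) (y x : Fin d → ℝ) :
    ∫ u, linearizationGap P S q η δ y x u ∂(sphereUniform d) ≤
      2 * ((k : ℝ) ^ (1 / q.toReal) * √d) * δ +
        1200 * η * ((k : ℝ) ^ (1 / q.toReal) * √d) ^ 2 * log d := by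
  have hg : Continuous fun u : EuclideanSpace ℝ (Fin d) => gradEst P S q δ x (WithLp.ofLp u) :=
    (continuous_gradEst hP δ).comp (g := fun z : (Fin d → ℝ) × (Fin d → ℝ) =>
      gradEst P S q δ z.1 z.2) (f := fun u : EuclideanSpace ℝ (Fin d) => (x, WithLp.ofLp u))
      (by fun_prop)
  have hgi : ∀ i, Continuous fun u : EuclideanSpace ℝ (Fin d) =>
      gradEst P S q δ x (WithLp.ofLp u) i := fun i => (continuous_apply i).comp hg
  have hi1 : Integrable (fun u : EuclideanSpace ℝ (Fin d) =>
      ∑ i, gradEst P S q δ x (WithLp.ofLp u) i * (x i - y i)) (sphereUniform d) :=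
    integrable_sphereUniform_of_continuous (by fun_prop)
  have hi2 : Integrable (fun u : EuclideanSpace ℝ (Fin d) =>
      4 * η * ‖gradEst P S q δ x (WithLp.ofLp u)‖ ^ 2) (sphereUniform d) :=
    integrable_sphereUniform_of_continuous (by fun_prop)
  unfold linearizationGap
  have hi3 : Integrable (fun u : EuclideanSpace ℝ (Fin d) =>
      queryValue P S q x - queryValue P S q y -
        ∑ i, gradEst P S q δ x (WithLp.ofLp u) i * (x i - y i)) (sphereUniform d) :=
    (integrable_const _).sub hi1
  rw [integral_add hi3 hi2, integral_sub (integrable_const _) hi1,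
    integral_const_mul, integral_const]
  simp only [probReal_univ, one_smul]
  have h1 := sub_le_integral_gradEst (q := q) hP hS hne hδ x y
  have h2 := mul_le_mul_of_nonneg_left (integral_norm_gradEst_sq_le (S := S) (q := q) hd hP hδ x)
    (show 0 ≤ 4 * η by positivity)
  linarith

end OneStep

/-! ### Measurability, independence and the bound along a run -/

section Algorithm

variable {d k : ℕ} [NeZero d] {P : Tensor d k} {S : Set (Fin k → ℝ)} {q : ℝ≥0∞} [Fact (1 ≤ q)]

omit [NeZero d] in
theorem dualIterate_congr {η δ : ℝ} {u v : ℕ → EuclideanSpace ℝ (Fin d)} {t : ℕ}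
    (h : ∀ s < t, u s = v s) : dualIterate P S q η δ u t = dualIterate P S q η δ v t := by
  induction t with
  | zero => rfl
  | succ t ih =>
    rw [dualIterate, dualIterate, ih fun s hs => h s (hs.trans t.lt_succ_self),
      h t t.lt_succ_self]

theorem iterate_eq_softmax (η δ : ℝ) (u : ℕ → EuclideanSpace ℝ (Fin d)) (t : ℕ) :
    iterate P S q η δ u t = softmax (dualIterate P S q η δ u t) :=
  mirrorStep_eq_softmax _

theorem continuous_dualIterate (hP : P ∈ preferenceTensors d k) (η δ : ℝ) (t : ℕ) :
    Continuous fun u : ℕ → EuclideanSpace ℝ (Fin d) => dualIterate P S q η δ u t := by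
  induction t with
  | zero => exact continuous_const
  | succ t ih =>
    simp only [dualIterate, mirrorStep_eq_softmax]
    refine ih.sub (Continuous.const_smul ?_ η)
    exact (continuous_gradEst hP δ).comp (g := fun z : (Fin d → ℝ) × (Fin d → ℝ) =>
      gradEst P S q δ z.1 z.2) (f := fun u : ℕ → EuclideanSpace ℝ (Fin d) =>
      (softmax (dualIterate P S q η δ u t), WithLp.ofLp (u t)))
      ((continuous_softmax.comp ih).prodMk ((PiLp.continuous_ofLp 2 _).comp (continuous_apply t)))

variable {Ω : Type*} [MeasurableSpace Ω] {μ : Measure Ω} [IsProbabilityMeasure μ]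
  {u : ℕ → Ω → EuclideanSpace ℝ (Fin d)} {T : ℕ}

omit [NeZero d] in
/-- The directions of the rounds before `t`, padded with zeros. -/
def pastDirections (u : ℕ → Ω → EuclideanSpace ℝ (Fin d)) (t : ℕ) (ω : Ω) (s : ℕ) :
    EuclideanSpace ℝ (Fin d) := if s < t then u s ω else 0

omit [NeZero d] [MeasurableSpace Ω] in
theorem dualIterate_pastDirections (η δ : ℝ) (t : ℕ) (ω : Ω) :
    dualIterate P S q η δ (pastDirections u t ω) t =
      dualIterate P S q η δ (fun s => u s ω) t :=
  dualIterate_congr fun s hs => by simp [pastDirections, hs]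

omit [IsProbabilityMeasure μ] in
-- Nothing is assumed about the directions from round T on, so they are replaced by zeros before
-- measurability is invoked.
theorem aemeasurable_dualIterate (hP : P ∈ preferenceTensors d k)
    (hu : ∀ t < T, AEMeasurable (u t) μ) (η δ : ℝ) {t : ℕ} (ht : t ≤ T) :
    AEMeasurable (fun ω => dualIterate P S q η δ (fun s => u s ω) t) μ := by
  simp only [← dualIterate_pastDirections (u := u)]
  refine (continuous_dualIterate hP η δ t).measurable.comp_aemeasurable
    (aemeasurable_pi_lambda _ fun s => ?_)
  unfold pastDirections
  by_cases hs : s < t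
  · simpa [hs] using hu s (hs.trans_le ht)
  · simp [hs]

omit [IsProbabilityMeasure μ] in
-- The dual iterate of round t is a measurable function of the directions with index below t, a
-- block disjoint from {t}.
theorem indepFun_dualIterate (hP : P ∈ preferenceTensors d k)
    (hu : ∀ t < T, AEMeasurable (u t) μ) (hind : iIndepFun (fun (t : Fin T) => u t) μ)
    (η δ : ℝ) {t : ℕ} (ht : t < T) :
    IndepFun (fun ω => dualIterate P S q η δ (fun s => u s ω) t) (u t) μ := by
  let A : Finset (Fin T) := Finset.univ.filter fun s => s.1 < t
  let B : Finset (Fin T) := {⟨t, ht⟩}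
  have hdisj : Disjoint A B := by
    simp [A, B]
  have h := hind.indepFun_finset₀ A B hdisj fun s => hu s s.2
  let pad : (A → EuclideanSpace ℝ (Fin d)) → ℕ → EuclideanSpace ℝ (Fin d) := fun z s =>
    if hs : s < t then z ⟨⟨s, hs.trans ht⟩, by simp [A, hs]⟩ else 0
  have hpad : Measurable pad := by
    refine measurable_pi_lambda _ fun s => ?_
    by_cases hs : s < t
    · simp only [pad, hs, dite_true]
      exact measurable_pi_apply _
    · simp only [pad, hs, dite_false]
      exact measurable_const
  have h2 := h.comp ((continuous_dualIterate (S := S) (q := q) hP η δ t).measurable.comp hpad)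
    (measurable_pi_apply (⟨⟨t, ht⟩, by simp [B]⟩ : B))
  convert h2 using 1
  · ext1 ω
    refine dualIterate_congr fun s hs => ?_
    simp [pad, hs]
  · rfl

omit [NeZero d] [IsProbabilityMeasure μ] in
theorem ae_norm_eq_one_of_hasLaw {X : Ω → EuclideanSpace ℝ (Fin d)}
    (hX : HasLaw X (sphereUniform d) μ) : ∀ᵐ ω ∂μ, ‖X ω‖ = 1 := by
  have h := ae_norm_eq_one_sphereUniform (d := d)
  rw [← hX.map_eq] at h
  exact ae_of_ae_map hX.aemeasurable h

theorem linearizationGap_iterate (hd : 2 ≤ d) (hP : P ∈ preferenceTensors d k)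
    (hS : Convex ℝ S) (hne : S.Nonempty)
    (hu : ∀ t < T, HasLaw (u t) (sphereUniform d) μ)
    (hind : iIndepFun (fun (t : Fin T) => u t) μ) {η δ : ℝ} (hη : 0 ≤ η) (hδ : 0 < δ)
    (y : Fin d → ℝ) {t : ℕ} (ht : t < T) :
    Integrable (fun ω => linearizationGap P S q η δ y
        (iterate P S q η δ (fun s => u s ω) t) (u t ω)) μ ∧
      ∫ ω, linearizationGap P S q η δ y (iterate P S q η δ (fun s => u s ω) t) (u t ω) ∂μ ≤
        2 * ((k : ℝ) ^ (1 / q.toReal) * √d) * δ +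
          1200 * η * ((k : ℝ) ^ (1 / q.toReal) * √d) ^ 2 * log d := by
  have hum : ∀ t < T, AEMeasurable (u t) μ := fun t ht => (hu t ht).aemeasurable
  simp only [iterate_eq_softmax]
  set Θ : Ω → Fin d → ℝ := fun ω => dualIterate P S q η δ (fun s => u s ω) t with hΘ
  have hΘm : AEMeasurable Θ μ := aemeasurable_dualIterate hP hum η δ ht.le
  let Ψ : (Fin d → ℝ) × EuclideanSpace ℝ (Fin d) → ℝ := fun z =>
    linearizationGap P S q η δ y (softmax z.1) z.2
  have hΨ : Continuous Ψ := (continuous_linearizationGap (S := S) (q := q) hP η δ y).comp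
    (f := fun z : (Fin d → ℝ) × EuclideanSpace ℝ (Fin d) => (softmax z.1, z.2))
    ((continuous_softmax.comp continuous_fst).prodMk continuous_snd)
  have hpair : AEMeasurable (fun ω => (Θ ω, u t ω)) μ := hΘm.prodMk (hum t ht)
  have hint : Integrable (fun ω => Ψ (Θ ω, u t ω)) μ := by
    -- The gap is continuous, and almost surely its arguments stay in the compact product of the
    -- simplex and the sphere.
    obtain ⟨C, hC⟩ := ((isCompact_stdSimplex ℝ (Fin d)).prod
      (isCompact_sphere (0 : EuclideanSpace ℝ (Fin d)) 1)).exists_bound_of_continuousOn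
      (continuous_linearizationGap (S := S) (q := q) hP η δ y).continuousOn
    refine Integrable.of_bound (hΨ.measurable.comp_aemeasurable hpair).aestronglyMeasurable C ?_
    filter_upwards [ae_norm_eq_one_of_hasLaw (hu t ht)] with ω hω
    exact hC (softmax (Θ ω), u t ω) ⟨softmax_mem_stdSimplex _, mem_sphere_zero_iff_norm.2 hω⟩
  refine ⟨hint, ?_⟩
  -- Independence permits integrating over the fresh direction with the iterate held fixed, where
  -- the one-step bound applies uniformly.
  have hmap : μ.map (fun ω => (Θ ω, u t ω)) = (μ.map Θ).prod (sphereUniform d) := by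
    rw [← (hu t ht).map_eq]
    exact (indepFun_iff_map_prod_eq_prod_map_map hΘm (hum t ht)).1
      (indepFun_dualIterate hP hum hind η δ ht)
  have hint' : Integrable Ψ ((μ.map Θ).prod (sphereUniform d)) := by
    rw [← hmap]
    exact (integrable_map_measure hΨ.aestronglyMeasurable hpair).2 hint
  have : IsProbabilityMeasure (μ.map Θ) := Measure.isProbabilityMeasure_map hΘm
  calc ∫ ω, Ψ (Θ ω, u t ω) ∂μ = ∫ z, Ψ z ∂((μ.map Θ).prod (sphereUniform d)) := by
        rw [← hmap, integral_map hpair hΨ.aestronglyMeasurable]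
    _ = ∫ θ, ∫ v, Ψ (θ, v) ∂(sphereUniform d) ∂(μ.map Θ) := integral_prod _ hint'
    _ ≤ ∫ _, (2 * ((k : ℝ) ^ (1 / q.toReal) * √d) * δ +
          1200 * η * ((k : ℝ) ^ (1 / q.toReal) * √d) ^ 2 * log d) ∂(μ.map Θ) :=
        integral_mono hint'.integral_prod_left (integrable_const _) fun θ =>
          integral_linearizationGap_le hd hP hS hne hη hδ y (softmax θ)
    _ = _ := by simp

theorem output_mem_stdSimplex (hT : 1 ≤ T) (η δ : ℝ) (v : ℕ → EuclideanSpace ℝ (Fin d)) :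
    output P S q η δ T v ∈ stdSimplex ℝ (Fin d) := by
  have hT' : (T : ℝ) ≠ 0 := by exact_mod_cast (by omega : T ≠ 0)
  rw [output, Finset.smul_sum]
  refine (convex_stdSimplex ℝ (Fin d)).sum_mem (fun _ _ => by positivity) ?_ fun t _ => ?_
  · simp [hT']
  · rw [iterate_eq_softmax]
    exact softmax_mem_stdSimplex _

/-- The deterministic half of the argument, valid for every sequence of directions: Jensen's
inequality for the average plus the regret bound. All randomness is left in the gaps, whose means
are bounded one round at a time. -/
theorem queryValue_output_le (hS : Convex ℝ S) (hne : S.Nonempty) (hT : 1 ≤ T)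
    {η δ : ℝ} (hη : 0 < η) (v : ℕ → EuclideanSpace ℝ (Fin d)) {y : Fin d → ℝ}
    (hy : y ∈ stdSimplex ℝ (Fin d)) :
    queryValue P S q (output P S q η δ T v) ≤ queryValue P S q y + (T : ℝ)⁻¹ *
      (∑ t ∈ Finset.range T, linearizationGap P S q η δ y (iterate P S q η δ v t) (v t) +
        log d / η) := by
  have hT' : (0 : ℝ) < T := by exact_mod_cast hT
  have h1 : queryValue P S q (output P S q η δ T v) ≤
      ∑ t ∈ Finset.range T, (T : ℝ)⁻¹ • queryValue P S q (iterate P S q η δ v t) := by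
    rw [output, Finset.smul_sum]
    refine (convexOn_queryValue q hS hne).map_sum_le (fun _ _ => by positivity) ?_
      fun _ _ => Set.mem_univ _
    simp [hT'.ne']
  have hreg := regret_le (θ := fun t => dualIterate P S q η δ v t)
    (g := fun t => gradEst P S q δ (iterate P S q η δ v t) (WithLp.ofLp (v t))) (η := η)
    rfl (fun t => rfl) hy T
  simp only [← iterate_eq_softmax] at hreg
  have e : ∑ t ∈ Finset.range T, linearizationGap P S q η δ y (iterate P S q η δ v t) (v t) =
      ∑ t ∈ Finset.range T, queryValue P S q (iterate P S q η δ v t) - T * queryValue P S q y -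
      ∑ t ∈ Finset.range T, ∑ i, gradEst P S q δ (iterate P S q η δ v t) (WithLp.ofLp (v t)) i *
        (iterate P S q η δ v t i - y i) + 4 * η * ∑ t ∈ Finset.range T,
        ‖gradEst P S q δ (iterate P S q η δ v t) (WithLp.ofLp (v t))‖ ^ 2 := by
    simp only [linearizationGap, Finset.sum_add_distrib, Finset.sum_sub_distrib, Finset.mul_sum]
    simp
  set R := ∑ t ∈ Finset.range T, ∑ i, gradEst P S q δ (iterate P S q η δ v t)
    (WithLp.ofLp (v t)) i * (iterate P S q η δ v t i - y i)
  set Q := ∑ t ∈ Finset.range T,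
    ‖gradEst P S q δ (iterate P S q η δ v t) (WithLp.ofLp (v t))‖ ^ 2
  have h2 : R ≤ log d / η + 4 * η * Q := by
    rw [← sub_le_iff_le_add, le_div_iff₀ hη]
    linarith
  refine h1.trans ?_
  rw [← Finset.smul_sum, e, smul_eq_mul]
  have h3 : ∑ t ∈ Finset.range T, queryValue P S q (iterate P S q η δ v t) ≤
      T * queryValue P S q y + (∑ t ∈ Finset.range T, queryValue P S q (iterate P S q η δ v t) -
      T * queryValue P S q y - R + 4 * η * Q + log d / η) := by linarith
  refine (mul_le_mul_of_nonneg_left h3 (inv_nonneg.2 hT'.le)).trans (le_of_eq ?_)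
  rw [mul_add, inv_mul_cancel_left₀ hT'.ne']

theorem integrable_queryValue_output (hP : P ∈ preferenceTensors d k)
    (hu : ∀ t < T, AEMeasurable (u t) μ) (hT : 1 ≤ T) (η δ : ℝ) :
    Integrable (fun ω => queryValue P S q (output P S q η δ T fun t => u t ω)) μ := by
  have hc := continuous_queryValue S q hP
  obtain ⟨C, hC⟩ := (isCompact_stdSimplex ℝ (Fin d)).exists_bound_of_continuousOn hc.continuousOn
  have hm : AEMeasurable (fun ω => output P S q η δ T fun t => u t ω) μ := by
    unfold output
    simp only [iterate_eq_softmax]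
    have h : ∀ t ∈ Finset.range T, AEMeasurable (fun ω =>
        softmax (dualIterate P S q η δ (fun s => u s ω) t)) μ := fun t ht =>
      continuous_softmax.measurable.comp_aemeasurable
        (aemeasurable_dualIterate hP hu η δ (Finset.mem_range.1 ht).le)
    exact (Finset.aemeasurable_fun_sum _ h).const_smul (T : ℝ)⁻¹
  exact Integrable.of_bound (hc.measurable.comp_aemeasurable hm).aestronglyMeasurable C
    (Eventually.of_forall fun ω => hC _ (output_mem_stdSimplex hT η δ _))

end Algorithm

end BlackwellPref

end

/-! ### Taking expectations and tuning the parameters -/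

theorem mainTheorem12 :
    ∀ c₁ c₂ : ℝ, 0 < c₁ → 0 < c₂ → ∃ C : ℝ, 0 < C ∧
      ∀ (d k T : ℕ), 2 ≤ d → 1 ≤ k → 1 ≤ T →
      ∀ (q : ℝ≥0∞) [Fact (1 ≤ q)] (P : BlackwellPref.Tensor d k) (S : Set (Fin k → ℝ)),
        P ∈ BlackwellPref.preferenceTensors d k →
        S.Nonempty → S ⊆ Set.Icc 0 1 → Convex ℝ S →
      ∀ {Ω : Type*} [MeasurableSpace Ω] (μ : Measure Ω) [IsProbabilityMeasure μ]
        (u : ℕ → Ω → EuclideanSpace ℝ (Fin d)),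
        (∀ t < T, HasLaw (u t) (BlackwellPref.sphereUniform d) μ) →
        iIndepFun (fun (t : Fin T) => u t) μ →
      ∀ (η δ : ℝ),
        η = c₁ / ((k : ℝ) ^ (1 / q.toReal) * √((d : ℝ) * (T : ℝ))) →
        δ = c₂ * Real.log d / √(T : ℝ) →
      ∃ m : ℝ,
        IsLeast (BlackwellPref.value P S q '' stdSimplex ℝ (Fin d)) m ∧
        Integrable (fun ω => BlackwellPref.value P S q
          (BlackwellPref.output P S q η δ T (fun t => u t ω))) μ ∧
        ∫ ω, BlackwellPref.value P S q
          (BlackwellPref.output P S q η δ T (fun t => u t ω)) ∂μ ≤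
          m + C * (k : ℝ) ^ (1 / q.toReal) * √((d : ℝ) * Real.log d ^ 2 / (T : ℝ)) := by
  intro c₁ c₂ hc₁ hc₂
  -- The summands come from the smoothing bias, the variance of the estimates and the initial
  -- potential log d / η, in this order.
  refine ⟨2 * c₂ + 1200 * c₁ + 1 / c₁, by positivity, ?_⟩
  intro d k T hd hk hT q _ P S hP hne _ hS Ω _ μ _ u hu hind η δ hη hδ
  have : NeZero d := ⟨by omega⟩
  have hd2 : (2 : ℝ) ≤ d := by exact_mod_cast hd
  have hd0 : (0 : ℝ) < d := by linarith
  have hk0 : (0 : ℝ) < k := by exact_mod_cast hk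
  have hT0 : (0 : ℝ) < T := by exact_mod_cast hT
  have hlog : 0 < Real.log d := Real.log_pos (by linarith)
  set κ : ℝ := (k : ℝ) ^ (1 / q.toReal) with hκ
  have hκ0 : 0 < κ := Real.rpow_pos_of_pos hk0 _
  have hsd : 0 < √(d : ℝ) := Real.sqrt_pos.2 hd0
  have hsT : 0 < √(T : ℝ) := Real.sqrt_pos.2 hT0
  have hη0 : 0 < η := by rw [hη]; positivity
  have hδ0 : 0 < δ := by rw [hδ]; positivity
  have hval : BlackwellPref.value P S q = BlackwellPref.queryValue P S q :=
    funext fun x => BlackwellPref.value_eq_queryValue q hS hne x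
  rw [hval]
  -- The minimizer also serves as the comparator in the regret bound.
  obtain ⟨y, hy, hmin⟩ := (isCompact_stdSimplex ℝ (Fin d)).exists_isMinOn
    ⟨_, single_mem_stdSimplex ℝ 0⟩ (BlackwellPref.continuous_queryValue S q hP).continuousOn
  have hint := BlackwellPref.integrable_queryValue_output (S := S) (q := q) hP
    (fun t ht => (hu t ht).aemeasurable) hT η δ
  refine ⟨BlackwellPref.queryValue P S q y, ⟨⟨y, hy, rfl⟩, ?_⟩, hint, ?_⟩
  · rintro _ ⟨x, hx, rfl⟩
    exact hmin hx
  have hgap := fun t (ht : t ∈ Finset.range T) => BlackwellPref.linearizationGap_iterate (q := q) hd hP hS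
    hne hu hind hη0.le hδ0 y (Finset.mem_range.1 ht)
  set B : ℝ := 2 * (κ * √d) * δ + 1200 * η * (κ * √d) ^ 2 * Real.log d with hB
  have hsum := integrable_finsetSum (Finset.range T) fun t ht => (hgap t ht).1
  have hsum' : Integrable (fun ω => (T : ℝ)⁻¹ * (∑ t ∈ Finset.range T,
      BlackwellPref.linearizationGap P S q η δ y
        (BlackwellPref.iterate P S q η δ (fun s => u s ω) t) (u t ω) + Real.log d / η)) μ :=
    (hsum.add (integrable_const _)).const_mul _
  calc ∫ ω, BlackwellPref.queryValue P S q
        (BlackwellPref.output P S q η δ T (fun t => u t ω)) ∂μ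
      ≤ ∫ ω, (BlackwellPref.queryValue P S q y + (T : ℝ)⁻¹ * (∑ t ∈ Finset.range T,
          BlackwellPref.linearizationGap P S q η δ y
            (BlackwellPref.iterate P S q η δ (fun s => u s ω) t) (u t ω) +
              Real.log d / η)) ∂μ :=
        integral_mono hint
          ((integrable_const _).add hsum')
          fun ω => BlackwellPref.queryValue_output_le hS hne hT hη0 (fun t => u t ω) hy
    _ = BlackwellPref.queryValue P S q y + (T : ℝ)⁻¹ * (∑ t ∈ Finset.range T,
          ∫ ω, BlackwellPref.linearizationGap P S q η δ y
            (BlackwellPref.iterate P S q η δ (fun s => u s ω) t) (u t ω) ∂μ +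
              Real.log d / η) := by
        rw [integral_add (integrable_const _) hsum',
          integral_const_mul, integral_add hsum (integrable_const _),
          integral_finsetSum _ fun t ht => (hgap t ht).1]
        simp
    _ ≤ BlackwellPref.queryValue P S q y + (T : ℝ)⁻¹ * (∑ _t ∈ Finset.range T, B +
          Real.log d / η) := by
        gcongr with t ht
        exact (hgap t ht).2
    _ = _ := by
        have h1 : √((d : ℝ) * Real.log d ^ 2 / T) = √d * Real.log d / √T := by
          rw [Real.sqrt_div (by positivity), Real.sqrt_mul hd0.le, Real.sqrt_sq hlog.le]
        have hdd : √(d : ℝ) ^ 2 = d := Real.sq_sqrt hd0.le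
        have hTT : √(T : ℝ) ^ 2 = T := Real.sq_sqrt hT0.le
        rw [h1, hB, hη, hδ, Real.sqrt_mul hd0.le, Finset.sum_const, Finset.card_range,
          nsmul_eq_mul]
        generalize √(T : ℝ) = a at *
        generalize √(d : ℝ) = b at *
        rw [← hTT]
        field_simp
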